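/- Let $N\ge 1$, $n\ge 0$, and consider the network of $N$ units $$\dot x_i=f_i(x_i)-\sigma\sum_{j=1}^N l_{ij}(x_i-x_j),\qquad x_i\in\mathbb R^n,\quad i=1,\dots,N,$$ with constant weights $l_{ij}\ge 0$ and coupling strength $\sigma>0$; equivalently $\dot x=F(x)-\sigma[L\otimes I_n]x$, where $x=(x_1,\dots,x_N)\in\mathbb R^{nN}$, $F(x)=(f_1(x_1),\dots,f_N(x_N))$ and $L$ is the Laplacian, $L_{ii}=\sum_{k\ne i}l_{ik}$ and $L_{ij}=-l_{ij}$ for $i\neq j$. Throughout, $|\cdot|$ is the Euclidean norm (the induced one for linear forms). Assume: 1. the directed graph with an edge $j\to i$ whenever $l_{ij}>0$ contains a rooted spanning tree (some node reaches every node along directed paths); 2. each $f_i:\mathbb R^n\to\mathbb R^n$ is continuously differentiable and $f_i(0)=0$; 3. each unit is input-to-state strictly semi-passive: there are a continuously differentiable, radially unbounded $V_i:\mathbb R^n\to\mathbb R_{\ge0}$, a constant $\rho_i>0$, a continuous $H_i:\mathbb R^n\to\mathbb R$ and a continuous $\psi_i$ with values in $\mathbb R_{\ge0}$ such that $\frac{\partial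 V_i}{\partial x^\top}(x)\,(f_i(x)+u)\le x^\top u-H_i(x)$ for all $x,u\in\mathbb R^n$, and $H_i(x)\ge\psi_i(|x|)$ whenever $|x|\ge\rho_i$. Let $v_l\in\mathbb R^N$ be the left null vector of $L$ with $v_l^\top L=0$, $1_N^\top v_l=1$, let $F_m(x_m)=\sum_{i=1}^N v_{l,i}f_i(x_m)$, and suppose that the origin of the reduced dynamics $\dot x_m=F_m(x_m)$ on $\mathbb R^n$ is globally asymptotically stable. (Global asymptotic stability means that all solutions exist on $[0,\infty)$, the origin is Lyapunov stable, and every solution converges to it.) Then: (i) The origin of the network is globally asymptotically practically stable with respect to $\varepsilon=1/\sigma$. That is, for each $\beta>0$ there is $\varepsilon^\star>0$ such that for each $\varepsilon\in(0,\varepsilon^\star]$ all solutions exist on $[0,\infty)$ and for each solution $x$ there is $T>0$ with $|x(t)|\le\beta$ for all $t\ge T$; and there is a function $\kappa$ of class $\mathcal K$ such that for each $\beta>0$ there is $\varepsilon^\star>0$ such that for each $\varepsilon\in(0,\varepsilon^\star]$ all solutions exist on $[0,\infty)$ and satisfy $|x(t)|\le\kappa(|x(0)|)+\beta$ for all $t\ge0$.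 (ii) Let $V\in\mathbb R^{N\times(N-1)}$ and $V^\dagger\in\mathbb R^{(N-1)\times N}$ be such that $U=[1_N\ \ V]$ is invertible, $U^{-1}=\begin{bmatrix}v_l^\top\\ V^\dagger\end{bmatrix}$ and $L=U\begin{bmatrix}0&0\\0&\Lambda\end{bmatrix}U^{-1}$ for some $\Lambda\in\mathbb R^{(N-1)\times(N-1)}$. For $x_m\in\mathbb R^n$ and $e_v\in\mathbb R^{n(N-1)}$ put $G_e(x_m,e_v)=[V^\dagger\otimes I_n]\,F\big([V\otimes I_n]e_v+[1_N\otimes I_n]x_m\big)$. Let $r>0$ be arbitrary (for instance an ultimate bound, uniform in large $\sigma$, of the solutions of the network). Assume that there are a continuously differentiable Lyapunov function $V_m:\mathbb R^n\to\mathbb R_{\ge0}$ ($V_m(0)=0$ and $V_m(x_m)>0$ for $x_m\ne0$), a function $\alpha$ of class $\mathcal K_\infty$ and a constant $c_r>0$ such that $$\frac{\partial V_m(x_m)}{\partial x_m^\top}F_m(x_m)\le-\alpha(|x_m|)^2\qquad\text{for all }|x_m|\le r,$$ $$\max\Big\{\big|G_e(x_m,e_v)-G_e(0,e_v)\big|,\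 \Big|\frac{\partial V_m(x_m)}{\partial x_m}\Big|\Big\}\le c_r\,\alpha(|x_m|)\qquad\text{for all }|x_m|^2+|e_v|^2\le r^2.$$ Then there is $\sigma^\star>0$ such that for all $\sigma\ge\sigma^\star$ the origin of the network is globally asymptotically stable. -/

import Mathlib

namespace DynNet

noncomputable section

/-! ### Autonomous differential equations and stability of the origin -/

section Stability

variable {E : Type*} [NormedAddCommGroup E] [NormedSpace ℝ E]

/-- `x` is a (forward, classical) solution of `x' = g x` on `[0, ∞)`. Since the equation is
autonomous, the initial time is taken to be `0`. -/
def IsSolution (g : E → E) (x : ℝ → E) : Prop :=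
  ∀ t : ℝ, 0 ≤ t → HasDerivWithinAt x (g (x t)) (Set.Ici 0) t

/-- Every initial state is the starting point of a solution defined on all of `[0, ∞)`. -/
def ForwardComplete (g : E → E) : Prop :=
  ∀ x₀ : E, ∃ x : ℝ → E, IsSolution g x ∧ x 0 = x₀

/-- The origin is globally asymptotically stable for `x' = g x`: solutions exist for all
future times, the origin is Lyapunov stable, and every solution converges to it. -/
structure GloballyAsymptoticallyStable (g : E → E) : Prop where
  complete : ForwardComplete g
  stable : ∀ η : ℝ, 0 < η → ∃ δ : ℝ, 0 < δ ∧
    ∀ x : ℝ → E, IsSolution g x → ‖x 0‖ ≤ δ → ∀ t : ℝ, 0 ≤ t → ‖x t‖ ≤ η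
  attractive : ∀ x : ℝ → E, IsSolution g x → Filter.Tendsto x Filter.atTop (nhds 0)

/-- A function of class `𝒦` (only its values on `[0, ∞)` matter). -/
structure ClassK (κ : ℝ → ℝ) : Prop where
  cont : ContinuousOn κ (Set.Ici 0)
  strictMono : StrictMonoOn κ (Set.Ici 0)
  map_zero : κ 0 = 0

/-- A function of class `𝒦_∞`. -/
structure ClassKInfty (κ : ℝ → ℝ) : Prop extends ClassK κ where
  unbounded : Filter.Tendsto κ Filter.atTop Filter.atTop

/-- Global practical attractivity of the origin for the family `x' = g ε x` as `ε → 0⁺`. -/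
def GloballyPracticallyAttractive (g : ℝ → E → E) : Prop :=
  ∀ β : ℝ, 0 < β → ∃ εs : ℝ, 0 < εs ∧ ∀ ε : ℝ, 0 < ε → ε ≤ εs →
    ForwardComplete (g ε) ∧
    ∀ x : ℝ → E, IsSolution (g ε) x → ∃ T : ℝ, 0 < T ∧ ∀ t : ℝ, T ≤ t → ‖x t‖ ≤ β

/-- Global practical stability of the origin for the family `x' = g ε x` as `ε → 0⁺`.
The function `κ` does not depend on `β`. -/
def GloballyPracticallyStable (g : ℝ → E → E) : Prop :=
  ∃ κ : ℝ → ℝ, ClassK κ ∧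
    ∀ β : ℝ, 0 < β → ∃ εs : ℝ, 0 < εs ∧ ∀ ε : ℝ, 0 < ε → ε ≤ εs →
      ForwardComplete (g ε) ∧
      ∀ x : ℝ → E, IsSolution (g ε) x → ∀ t : ℝ, 0 ≤ t → ‖x t‖ ≤ κ ‖x 0‖ + β

/-- Global asymptotic practical stability of the origin. -/
def GloballyAsymptoticallyPracticallyStable (g : ℝ → E → E) : Prop :=
  GloballyPracticallyAttractive g ∧ GloballyPracticallyStable g

end Stability

/-! ### The network -/

/-- The state space `ℝⁿ` of one unit, with the Euclidean norm. -/
abbrev Vec (n : ℕ) : Type := EuclideanSpace ℝ (Fin n)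

/-- Stacks of `k` vectors of `ℝⁿ`, that is `ℝ^{nk}` with the Euclidean norm. -/
abbrev Stack (k n : ℕ) : Type := PiLp 2 (fun _ : Fin k => Vec n)

variable {N n : ℕ}

/-- The matrix `A ⊗ Iₙ` acting on stacked vectors. -/
def kronAct {p q : ℕ} (A : Matrix (Fin p) (Fin q) ℝ) (x : Stack q n) : Stack p n :=
  WithLp.toLp 2 (fun i => ∑ j, A i j • x j)

/-- The Laplacian of the graph with weights `l i j` (weight of the edge from `j` to `i`). -/
def laplacian (l : Fin N → Fin N → ℝ) : Matrix (Fin N) (Fin N) ℝ :=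
  Matrix.of fun i j => if i = j then ∑ k ∈ Finset.univ.erase i, l i k else -l i j

/-- The directed graph with an edge from `j` to `i` whenever `l i j > 0` contains a rooted
spanning tree: some node reaches all nodes along directed paths. -/
def ConnectedDigraph (l : Fin N → Fin N → ℝ) : Prop :=
  ∃ root : Fin N, ∀ i : Fin N, Relation.ReflTransGen (fun a b => 0 < l b a) root i

/-- `F(x) = (f₁(x₁), …, f_N(x_N))`. -/
def stackedField (f : Fin N → Vec n → Vec n) (x : Stack N n) : Stack N n :=
  WithLp.toLp 2 (fun i => f i (x i))

/-- The right-hand side `F(x) - σ [L ⊗ Iₙ] x` of the network. -/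
def networkField (l : Fin N → Fin N → ℝ) (f : Fin N → Vec n → Vec n) (σ : ℝ)
    (x : Stack N n) : Stack N n :=
  stackedField f x - σ • kronAct (laplacian l) x

/-- Input-to-state strict semi-passivity of the unit `x' = f x + u`; the dissipation
inequality holds for all states and all values of the input. -/
def StrictlySemiPassive (f : Vec n → Vec n) : Prop :=
  ∃ (W : Vec n → ℝ) (ρ : ℝ) (H : Vec n → ℝ) (ψ : ℝ → ℝ),
    ContDiff ℝ 1 W ∧ (∀ x, 0 ≤ W x) ∧
    Filter.Tendsto W (Filter.cocompact (Vec n)) Filter.atTop ∧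
    0 < ρ ∧ Continuous H ∧ Continuous ψ ∧ (∀ s, 0 ≤ ψ s) ∧
    (∀ x u : Vec n, fderiv ℝ W x (f x + u) ≤ inner ℝ x u - H x) ∧
    (∀ x : Vec n, ρ ≤ ‖x‖ → ψ ‖x‖ ≤ H x)

/-- `v` is a left null vector of the Laplacian whose entries sum to one. -/
structure IsLeftEigenvector (l : Fin N → Fin N → ℝ) (v : Fin N → ℝ) : Prop where
  null : Matrix.vecMul v (laplacian l) = 0
  sum_eq_one : ∑ i, v i = 1

/-- The reduced-order vector field `F_m(x_m) = ∑ᵢ vᵢ fᵢ(x_m)`. -/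
def reducedField (f : Fin N → Vec n → Vec n) (v : Fin N → ℝ) (xm : Vec n) : Vec n :=
  ∑ i, v i • f i xm

/-- The block decomposition `L = U diag(0, Λ) U⁻¹` with `U = [1 V]` and `U⁻¹ = [vᵀ; V†]`.
The first four fields, with `∑ vᵢ = 1`, say that the two block matrices are mutually inverse,
and the last one is the decomposition, where the first column of `U` is multiplied by `0`. -/
structure IsBlockDecomposition (l : Fin N → Fin N → ℝ) (v : Fin N → ℝ)
    (V : Matrix (Fin N) (Fin (N - 1)) ℝ) (Vd : Matrix (Fin (N - 1)) (Fin N) ℝ) : Prop where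
  left_mul : Matrix.vecMul v V = 0
  mul_one : Matrix.mulVec Vd (fun _ => 1) = 0
  mul_self : Vd * V = 1
  self_mul : V * Vd = 1 - Matrix.vecMulVec (fun _ => 1) v
  block : ∃ Λ : Matrix (Fin (N - 1)) (Fin (N - 1)) ℝ, laplacian l = V * Λ * Vd

/-- `[1_N ⊗ Iₙ] x_m`. -/
def diagStack (xm : Vec n) : Stack N n := WithLp.toLp 2 (fun _ => xm)

/-- `G_e(x_m, e_v) = [V† ⊗ Iₙ] F([V ⊗ Iₙ] e_v + [1_N ⊗ Iₙ] x_m)`. -/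
def syncField (f : Fin N → Vec n → Vec n) (V : Matrix (Fin N) (Fin (N - 1)) ℝ)
    (Vd : Matrix (Fin (N - 1)) (Fin N) ℝ) (xm : Vec n) (ev : Stack (N - 1) n) :
    Stack (N - 1) n :=
  kronAct Vd (stackedField f (kronAct V ev + diagStack xm))

/-- The conditions on the Lyapunov function `Vm` of the reduced-order dynamics, on the closed
ball of radius `r` of the space of the `(x_m, e_v)`. -/
structure DecayAndGrowth (f : Fin N → Vec n → Vec n) (v : Fin N → ℝ)
    (V : Matrix (Fin N) (Fin (N - 1)) ℝ) (Vd : Matrix (Fin (N - 1)) (Fin N) ℝ) (r : ℝ)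
    (Vm : Vec n → ℝ) (α : ℝ → ℝ) (c : ℝ) : Prop where
  contDiff : ContDiff ℝ 1 Vm
  map_zero : Vm 0 = 0
  pos : ∀ xm : Vec n, xm ≠ 0 → 0 < Vm xm
  classKInfty : ClassKInfty α
  c_pos : 0 < c
  decay : ∀ xm : Vec n, ‖xm‖ ≤ r → fderiv ℝ Vm xm (reducedField f v xm) ≤ -(α ‖xm‖) ^ 2
  growth : ∀ (xm : Vec n) (ev : Stack (N - 1) n), ‖xm‖ ^ 2 + ‖ev‖ ^ 2 ≤ r ^ 2 →
    max ‖syncField f V Vd xm ev - syncField f V Vd 0 ev‖ ‖fderiv ℝ Vm xm‖ ≤ c * α ‖xm‖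

end

end DynNet

/-! Split the state into the mean field `x_m = ∑ v_i x_i` and the error `e = x - 1 ⊗ x_m`. Since `vᵀ
L = 0`, the coupling drops out of the equation of `x_m`, whereas `e` is driven by the error part of
`F` and damped by `-σ L e`. As `-L` is exponentially stable on `∑ v_i e_i = 0`, a large `σ` makes
`e` small after a short time, and from then on `x_m` obeys a small perturbation of the reduced
dynamics.

Stability of `-L` is obtained without spectral theory. The matrix `1 - h L` is row stochastic and
some power has a positive column at the root, so its powers approach `1 vᵀ`
(`exists_eulerMatrix_pow_near`). A finite sum of squared norms of these powers is a quadratic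
Lyapunov function (`exists_consensus_lyapunov`). The same limit shows that `v ≥ 0` and that `v` is
supported on every nonempty set closed under in-neighbours.

Boundedness: an inequality affine in the input and valid for all inputs forces `∇W(x) = x`, hence
`⟨x, f_i x⟩ ≤ 0` outside a ball of radius `ρ`. The largest unit norm therefore cannot grow above
`ρ`. The decay need not be strict, so absorption into larger balls needs a LaSalle argument
(`not_forall_maxNorm_eq`, `exists_maxNorm_le`). On a limit solution with constant maximal norm above
`ρ`, some unit stays on the sphere, and everything upstream of it coincides with it. That set
carries `v`, so the common trajectory solves the reduced equation, whose solutions tend to `0`: a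
contradiction.

For (i), attraction of the reduced dynamics is uniform on compact sets, and Grönwall's inequality is
used over one finite horizon only (`exists_practical_bounds`). For (ii), `V_m(x_m) + W(e)` is a
strict Lyapunov function on a ball whose radius does not depend on `σ` (`exists_network_lyapunov`);
by practical attractivity every solution ends up in that ball once `σ` is large. -/

namespace DynNet

open Matrix Filter Topology Set

variable {N n : ℕ}

/-! ### The Euler matrix of the Laplacian -/

/-- A step size for which `1 - h • L` is row stochastic with positive diagonal. -/
noncomputable def eulerStep (l : Fin N → Fin N → ℝ) : ℝ := (1 + ∑ i, ∑ j, l i j)⁻¹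

/-- The matrix `1 - h • L` of the explicit Euler scheme for `x' = - L x`. -/
noncomputable def eulerMatrix (l : Fin N → Fin N → ℝ) : Matrix (Fin N) (Fin N) ℝ :=
  1 - eulerStep l • laplacian l

lemma eulerStep_pos {l : Fin N → Fin N → ℝ} (hl : ∀ i j, 0 ≤ l i j) : 0 < eulerStep l :=
  inv_pos.2 (add_pos_of_pos_of_nonneg one_pos
    (Finset.sum_nonneg fun i _ => Finset.sum_nonneg fun j _ => hl i j))

lemma laplacian_apply_ne (l : Fin N → Fin N → ℝ) {i j : Fin N} (h : i ≠ j) :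
    laplacian l i j = -l i j := by
  simp [laplacian, h]

lemma laplacian_apply_self (l : Fin N → Fin N → ℝ) (i : Fin N) :
    laplacian l i i = ∑ k ∈ Finset.univ.erase i, l i k := by
  simp [laplacian]

lemma sum_laplacian_smul {E : Type*} [AddCommGroup E] [Module ℝ E] (l : Fin N → Fin N → ℝ)
    (x : Fin N → E) (i : Fin N) :
    ∑ j, laplacian l i j • x j = ∑ j, l i j • (x i - x j) := by
  rw [← Finset.add_sum_erase _ _ (Finset.mem_univ i),
    ← Finset.add_sum_erase (a := i) _ (fun j => l i j • (x i - x j)) (Finset.mem_univ i),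
    laplacian_apply_self, Finset.sum_smul, ← Finset.sum_add_distrib]
  simp only [sub_self, smul_zero, zero_add]
  refine Finset.sum_congr rfl fun j hj => ?_
  rw [laplacian_apply_ne l (Finset.ne_of_mem_erase hj).symm]
  module

lemma sum_laplacian (l : Fin N → Fin N → ℝ) (i : Fin N) : ∑ j, laplacian l i j = 0 := by
  simpa using sum_laplacian_smul l (fun _ => (1 : ℝ)) i

lemma eulerMatrix_apply_ne (l : Fin N → Fin N → ℝ) {i j : Fin N} (h : i ≠ j) :
    eulerMatrix l i j = eulerStep l * l i j := by
  simp [eulerMatrix, laplacian_apply_ne l h, h]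

lemma eulerMatrix_apply_self_pos {l : Fin N → Fin N → ℝ} (hl : ∀ i j, 0 ≤ l i j) (i : Fin N) :
    0 < eulerMatrix l i i := by
  have h1 : ∑ k ∈ Finset.univ.erase i, l i k ≤ ∑ i, ∑ j, l i j :=
    (Finset.sum_le_sum_of_subset_of_nonneg (Finset.erase_subset _ _)
      fun j _ _ => hl i j).trans
      (Finset.single_le_sum (f := fun i => ∑ j, l i j)
        (fun i _ => Finset.sum_nonneg fun j _ => hl i j) (Finset.mem_univ i))
  have h2 : (0 : ℝ) ≤ ∑ i, ∑ j, l i j :=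
    Finset.sum_nonneg fun i _ => Finset.sum_nonneg fun j _ => hl i j
  have h3 : eulerStep l * ∑ k ∈ Finset.univ.erase i, l i k < 1 := by
    rw [eulerStep, inv_mul_lt_one₀ (by linarith)]
    linarith
  simpa [eulerMatrix, laplacian_apply_self] using h3

lemma eulerMatrix_nonneg {l : Fin N → Fin N → ℝ} (hl : ∀ i j, 0 ≤ l i j) (i j : Fin N) :
    0 ≤ eulerMatrix l i j := by
  rcases eq_or_ne i j with rfl | h
  · exact (eulerMatrix_apply_self_pos hl i).le
  · rw [eulerMatrix_apply_ne l h]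
    exact mul_nonneg (eulerStep_pos hl).le (hl i j)

lemma eulerMatrix_mem_rowStochastic {l : Fin N → Fin N → ℝ} (hl : ∀ i j, 0 ≤ l i j) :
    eulerMatrix l ∈ rowStochastic ℝ (Fin N) := by
  rw [mem_rowStochastic_iff_sum]
  refine ⟨eulerMatrix_nonneg hl, fun i => ?_⟩
  simp [eulerMatrix, Finset.sum_sub_distrib, ← Finset.mul_sum, sum_laplacian, Matrix.one_apply]

lemma eulerMatrix_pow_nonneg {l : Fin N → Fin N → ℝ} (hl : ∀ i j, 0 ≤ l i j) (m : ℕ)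
    (i j : Fin N) : 0 ≤ (eulerMatrix l ^ m) i j :=
  (mem_rowStochastic_iff_sum.1 (pow_mem (eulerMatrix_mem_rowStochastic hl) m)).1 i j

lemma sum_eulerMatrix_pow {l : Fin N → Fin N → ℝ} (hl : ∀ i j, 0 ≤ l i j) (m : ℕ)
    (i : Fin N) : ∑ j, (eulerMatrix l ^ m) i j = 1 :=
  (mem_rowStochastic_iff_sum.1 (pow_mem (eulerMatrix_mem_rowStochastic hl) m)).2 i

lemma eulerMatrix_pow_succ_pos {l : Fin N → Fin N → ℝ} (hl : ∀ i j, 0 ≤ l i j) {m : ℕ}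
    {i j k : Fin N} (h1 : 0 < eulerMatrix l i j) (h2 : 0 < (eulerMatrix l ^ m) j k) :
    0 < (eulerMatrix l ^ (m + 1)) i k := by
  rw [pow_succ', Matrix.mul_apply]
  exact Finset.sum_pos' (fun a _ => mul_nonneg (eulerMatrix_nonneg hl i a)
    (eulerMatrix_pow_nonneg hl m a k)) ⟨j, Finset.mem_univ j, mul_pos h1 h2⟩

/-- Each edge of a path from the root costs one step, and the positive diagonal allows waiting at
the root, so positivity persists for all larger exponents. The sum of the individual thresholds then
serves all rows at once. -/
lemma exists_eulerMatrix_pow_column_pos {l : Fin N → Fin N → ℝ} (hl : ∀ i j, 0 ≤ l i j)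
    {root : Fin N} (hroot : ∀ i, Relation.ReflTransGen (fun a b => 0 < l b a) root i) :
    ∃ m : ℕ, ∃ θ : ℝ, 0 < θ ∧ ∀ i, θ ≤ (eulerMatrix l ^ m) i root := by
  have key : ∀ i, ∃ m₀ : ℕ, ∀ m, m₀ ≤ m → 0 < (eulerMatrix l ^ m) i root := by
    intro i
    induction hroot i with
    | refl =>
      refine ⟨0, fun m _ => ?_⟩
      induction m with
      | zero => simp
      | succ m ih =>
        exact eulerMatrix_pow_succ_pos hl (eulerMatrix_apply_self_pos hl root) (ih (Nat.zero_le m))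
    | @tail a b _ hab ih =>
      obtain ⟨m₀, h⟩ := ih
      rcases eq_or_ne b a with rfl | hne
      · exact ⟨m₀, h⟩
      refine ⟨m₀ + 1, fun m hm => ?_⟩
      obtain ⟨k, rfl⟩ : ∃ k, m = k + 1 := ⟨m - 1, by omega⟩
      refine eulerMatrix_pow_succ_pos hl ?_ (h k (by omega))
      rw [eulerMatrix_apply_ne l hne]
      exact mul_pos (eulerStep_pos hl) hab
  choose m₀ hm₀ using key
  have hpos : ∀ i, 0 < (eulerMatrix l ^ (∑ i, m₀ i)) i root := fun i =>
    hm₀ i _ (Finset.single_le_sum (f := m₀) (fun _ _ => Nat.zero_le _) (Finset.mem_univ i))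
  have : Nonempty (Fin N) := ⟨root⟩
  obtain ⟨i₀, h⟩ := Finite.exists_min fun i => (eulerMatrix l ^ (∑ i, m₀ i)) i root
  exact ⟨_, _, hpos i₀, h⟩

/-- A row stochastic matrix with a column bounded below contracts the spread of a vector. -/
lemma abs_sum_sub_sum_le_of_rowStochastic {B : Matrix (Fin N) (Fin N) ℝ}
    (hB : B ∈ rowStochastic ℝ (Fin N)) {θ : ℝ} (hθ : 0 ≤ θ) {r : Fin N} (hr : ∀ i, θ ≤ B i r)
    {x : Fin N → ℝ} {D : ℝ} (hx : ∀ k k', |x k - x k'| ≤ D) (i j : Fin N) :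
    |∑ k, B i k * x k - ∑ k, B j k * x k| ≤ (1 - θ ^ 2) * D := by
  obtain ⟨h0, h1⟩ := mem_rowStochastic_iff_sum.1 hB
  have hD : 0 ≤ D := (abs_nonneg _).trans (hx r r)
  -- Under the product of the two row distributions the difference is the mean of `x k - x k'`. The
  -- pair `(r, r)` has mass at least `θ ^ 2` and contributes nothing.
  have e1 : ∑ k, B i k * x k - ∑ k, B j k * x k
      = ∑ k, ∑ k', B i k * B j k' * (x k - x k') := by
    have ha : ∑ k, B i k * x k = ∑ k, ∑ k', B i k * B j k' * x k := by
      refine Finset.sum_congr rfl fun k _ => ?_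
      rw [← Finset.sum_mul, ← Finset.mul_sum, h1, mul_one]
    have hb : ∑ k, B j k * x k = ∑ k, ∑ k', B i k * B j k' * x k' := by
      rw [Finset.sum_comm]
      refine Finset.sum_congr rfl fun k _ => ?_
      rw [← Finset.sum_mul, ← Finset.sum_mul, h1, one_mul]
    rw [ha, hb, ← Finset.sum_sub_distrib]
    refine Finset.sum_congr rfl fun k _ => ?_
    rw [← Finset.sum_sub_distrib]
    exact Finset.sum_congr rfl fun k' _ => by ring
  have e2 : ∑ k, ∑ k', B i k * B j k' * D = D := by
    have : ∀ k, ∑ k', B i k * B j k' * D = B i k * D := fun k => by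
      rw [← Finset.sum_mul, ← Finset.mul_sum, h1, mul_one]
    simp only [this, ← Finset.sum_mul, h1, one_mul]
  have e3 : ∀ k k', |B i k * B j k' * (x k - x k')| ≤
      B i k * B j k' * D - if k = r then (if k' = r then B i r * B j r * D else 0) else 0 := by
    intro k k'
    have hBB : 0 ≤ B i k * B j k' := mul_nonneg (h0 i k) (h0 j k')
    have h4 : |B i k * B j k' * (x k - x k')| ≤ B i k * B j k' * D := by
      rw [abs_mul, abs_of_nonneg hBB]
      exact mul_le_mul_of_nonneg_left (hx k k') hBB
    by_cases hk : k = r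
    · by_cases hk' : k' = r
      · subst hk; subst hk'; simp
      · rw [if_pos hk, if_neg hk', sub_zero]; exact h4
    · rwa [if_neg hk, sub_zero]
  rw [e1]
  calc |∑ k, ∑ k', B i k * B j k' * (x k - x k')|
      ≤ ∑ k, ∑ k', |B i k * B j k' * (x k - x k')| :=
        (Finset.abs_sum_le_sum_abs _ _).trans
          (Finset.sum_le_sum fun k _ => Finset.abs_sum_le_sum_abs _ _)
    _ ≤ ∑ k, ∑ k', (B i k * B j k' * D -
          if k = r then (if k' = r then B i r * B j r * D else 0) else 0) :=
        Finset.sum_le_sum fun k _ => Finset.sum_le_sum fun k' _ => e3 k k'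
    _ = D - B i r * B j r * D := by
        simp only [Finset.sum_sub_distrib, e2]
        congr 1
        have : ∀ k, ∑ k', (if k = r then (if k' = r then B i r * B j r * D else 0) else 0)
            = if k = r then B i r * B j r * D else 0 := fun k => by
          by_cases hk : k = r <;> simp [hk]
        simp [this]
    _ ≤ (1 - θ ^ 2) * D := by
        have : θ ^ 2 ≤ B i r * B j r := by
          rw [sq]; exact mul_le_mul (hr i) (hr j) hθ (h0 i r)
        nlinarith

lemma vecMul_eulerMatrix_pow {l : Fin N → Fin N → ℝ} {v : Fin N → ℝ}
    (hv : IsLeftEigenvector l v) (m : ℕ) : v ᵥ* (eulerMatrix l ^ m) = v := by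
  induction m with
  | zero => simp
  | succ m ih =>
    rw [pow_succ, ← Matrix.vecMul_vecMul, ih, eulerMatrix, Matrix.vecMul_sub,
      Matrix.vecMul_smul, hv.null]
    simp

/-- Powers of the Euler matrix approach the projection `1 vᵀ`. -/
lemma exists_eulerMatrix_pow_near {l : Fin N → Fin N → ℝ} {v : Fin N → ℝ}
    (hl : ∀ i j, 0 ≤ l i j) (hgraph : ConnectedDigraph l) (hv : IsLeftEigenvector l v)
    {ε : ℝ} (hε : 0 < ε) : ∃ m : ℕ, ∀ i k, |(eulerMatrix l ^ m) i k - v k| ≤ ε := by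
  obtain ⟨root, hroot⟩ := hgraph
  obtain ⟨K, θ, hθ, hcol⟩ := exists_eulerMatrix_pow_column_pos hl hroot
  have hθ1 : θ ≤ 1 := by
    refine (hcol root).trans ?_
    rw [← sum_eulerMatrix_pow hl K root]
    exact Finset.single_le_sum (fun j _ => eulerMatrix_pow_nonneg hl K root j)
      (Finset.mem_univ root)
  -- The rows merge geometrically: each further factor `eulerMatrix l ^ K` contracts the spread of
  -- every column.
  have hspread : ∀ (q : ℕ) (i j k : Fin N),
      |(eulerMatrix l ^ (K * q)) i k - (eulerMatrix l ^ (K * q)) j k| ≤ (1 - θ ^ 2) ^ q := by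
    intro q
    induction q with
    | zero =>
      intro i j k
      simp only [mul_zero, pow_zero, Matrix.one_apply]
      split_ifs <;> simp
    | succ q ih =>
      intro i j k
      have := abs_sum_sub_sum_le_of_rowStochastic
        (pow_mem (eulerMatrix_mem_rowStochastic hl) K) hθ.le hcol
        (x := fun a => (eulerMatrix l ^ (K * q)) a k) (fun a b => ih a b k) i j
      rw [Nat.mul_succ, Nat.add_comm, pow_add, Matrix.mul_apply, Matrix.mul_apply, pow_succ']
      exact this
  have hlim : Tendsto (fun q : ℕ => (∑ j, |v j|) * (1 - θ ^ 2) ^ q) atTop (𝓝 0) := by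
    have := (tendsto_pow_atTop_nhds_zero_of_lt_one (r := 1 - θ ^ 2) (by nlinarith)
      (by nlinarith)).const_mul (∑ j, |v j|)
    simpa using this
  obtain ⟨q, hq⟩ := (hlim.eventually (gt_mem_nhds hε)).exists
  refine ⟨K * q, fun i k => le_trans ?_ hq.le⟩
  -- By invariance, `v k` is the `v`-weighted sum of the entries of column `k`. The sign of `v` is
  -- not yet known, hence the factor `∑ j, |v j|` in the estimate.
  have hvk : v k = ∑ j, v j * (eulerMatrix l ^ (K * q)) j k := by
    conv_lhs => rw [← vecMul_eulerMatrix_pow hv (K * q)]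
    rfl
  have : (eulerMatrix l ^ (K * q)) i k - v k
      = ∑ j, v j * ((eulerMatrix l ^ (K * q)) i k - (eulerMatrix l ^ (K * q)) j k) := by
    simp only [mul_sub, Finset.sum_sub_distrib, ← Finset.sum_mul, hv.sum_eq_one, one_mul, ← hvk]
  rw [this, Finset.sum_mul]
  refine (Finset.abs_sum_le_sum_abs _ _).trans (Finset.sum_le_sum fun j _ => ?_)
  rw [abs_mul]
  exact mul_le_mul_of_nonneg_left (hspread q i j k) (abs_nonneg _)

/-- The entries of `v` are approximated by entries of nonnegative matrices. -/
lemma IsLeftEigenvector.nonneg {l : Fin N → Fin N → ℝ} {v : Fin N → ℝ}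
    (hl : ∀ i j, 0 ≤ l i j) (hgraph : ConnectedDigraph l) (hv : IsLeftEigenvector l v)
    (k : Fin N) : 0 ≤ v k := by
  refine le_of_forall_pos_le_add fun ε hε => ?_
  obtain ⟨m, hm⟩ := exists_eulerMatrix_pow_near hl hgraph hv hε
  have h1 := (abs_le.1 (hm k k)).2
  have h2 := eulerMatrix_pow_nonneg hl m k k
  linarith

/-- The left null vector vanishes off every nonempty set of nodes closed under in-neighbours. -/
lemma IsLeftEigenvector.eq_zero_of_notMem {l : Fin N → Fin N → ℝ} {v : Fin N → ℝ}
    (hl : ∀ i j, 0 ≤ l i j) (hgraph : ConnectedDigraph l) (hv : IsLeftEigenvector l v)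
    {J : Set (Fin N)} (hJ : J.Nonempty) (hclosed : ∀ i ∈ J, ∀ j, 0 < l i j → j ∈ J)
    {k : Fin N} (hk : k ∉ J) : v k = 0 := by
  -- A walk that follows incoming edges backwards never leaves `J`, so these entries vanish in every
  -- power, and `v k` is approximated by them.
  have hzero : ∀ (m : ℕ), ∀ i ∈ J, (eulerMatrix l ^ m) i k = 0 := by
    intro m
    induction m with
    | zero =>
      intro i hi
      have : i ≠ k := fun h => hk (h ▸ hi)
      simp [this]
    | succ m ih =>
      intro i hi
      rw [pow_succ', Matrix.mul_apply]
      refine Finset.sum_eq_zero fun j _ => ?_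
      by_cases hj : j ∈ J
      · rw [ih j hj, mul_zero]
      · have hne : i ≠ j := fun h => hj (h ▸ hi)
        have : l i j = 0 := le_antisymm (not_lt.1 fun h => hj (hclosed i hi j h)) (hl i j)
        rw [eulerMatrix_apply_ne l hne, this, mul_zero, zero_mul]
  obtain ⟨i, hi⟩ := hJ
  refine abs_eq_zero.1 (le_antisymm (le_of_forall_pos_le_add fun ε hε => ?_) (abs_nonneg _))
  obtain ⟨m, hm⟩ := exists_eulerMatrix_pow_near hl hgraph hv hε
  have := hm i k
  rw [hzero m i hi, zero_sub, abs_neg] at this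
  linarith

/-! ### Stacked vectors -/

section Stacks

variable {N n : ℕ}

@[simp]
lemma kronAct_apply {p q : ℕ} (A : Matrix (Fin p) (Fin q) ℝ) (x : Stack q n) (i : Fin p) :
    kronAct A x i = ∑ j, A i j • x j := rfl

lemma kronAct_add {p q : ℕ} (A : Matrix (Fin p) (Fin q) ℝ) (x y : Stack q n) :
    kronAct A (x + y) = kronAct A x + kronAct A y := by
  ext i : 1
  simp [Finset.sum_add_distrib]

lemma kronAct_smul {p q : ℕ} (A : Matrix (Fin p) (Fin q) ℝ) (c : ℝ) (x : Stack q n) :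
    kronAct A (c • x) = c • kronAct A x := by
  ext i : 1
  simp [Finset.smul_sum, smul_comm c]

/-- `A ⊗ Iₙ` as a linear map. -/
noncomputable def kronLin {p q : ℕ} (n : ℕ) (A : Matrix (Fin p) (Fin q) ℝ) :
    Stack q n →ₗ[ℝ] Stack p n where
  toFun := kronAct A
  map_add' := kronAct_add A
  map_smul' := kronAct_smul A

/-- `A ⊗ Iₙ` as a continuous linear map. -/
noncomputable def kronCLM {p q : ℕ} (n : ℕ) (A : Matrix (Fin p) (Fin q) ℝ) :
    Stack q n →L[ℝ] Stack p n :=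
  ⟨kronLin n A, (PiLp.continuous_toLp 2 _).comp (continuous_pi fun i =>
    continuous_finsetSum _ fun j _ => (PiLp.continuous_apply 2 (fun _ : Fin q => Vec n) j).const_smul (A i j))⟩

@[simp]
lemma kronCLM_apply {p q : ℕ} (A : Matrix (Fin p) (Fin q) ℝ) (x : Stack q n) :
    kronCLM n A x = kronAct A x := rfl

lemma kronAct_mul {p q s : ℕ} (A : Matrix (Fin p) (Fin q) ℝ) (B : Matrix (Fin q) (Fin s) ℝ)
    (x : Stack s n) : kronAct (A * B) x = kronAct A (kronAct B x) := by
  ext i : 1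
  simp only [kronAct_apply, Matrix.mul_apply, Finset.sum_smul, Finset.smul_sum, mul_smul]
  exact Finset.sum_comm

lemma kronAct_one (x : Stack N n) : kronAct (1 : Matrix (Fin N) (Fin N) ℝ) x = x := by
  ext i : 1
  simp [Matrix.one_apply]

lemma kronAct_eulerMatrix (l : Fin N → Fin N → ℝ) (x : Stack N n) :
    kronAct (eulerMatrix l) x = x - eulerStep l • kronAct (laplacian l) x := by
  ext i : 1
  simp [eulerMatrix, sub_smul, Finset.sum_sub_distrib, Matrix.one_apply, Finset.smul_sum,
    mul_smul]

lemma norm_apply_le (x : Stack N n) (i : Fin N) : ‖x i‖ ≤ ‖x‖ := PiLp.norm_apply_le x i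

lemma norm_le_sum (x : Stack N n) : ‖x‖ ≤ ∑ i, ‖x i‖ := by
  rw [PiLp.norm_eq_of_L2]
  refine Real.sqrt_le_iff.2 ⟨Finset.sum_nonneg fun i _ => norm_nonneg _, ?_⟩
  exact Finset.sum_sq_le_sq_sum_of_nonneg fun i _ => norm_nonneg _

lemma norm_le_of_forall_norm_apply_le {x : Stack N n} {R : ℝ} (h : ∀ i, ‖x i‖ ≤ R) :
    ‖x‖ ≤ N * R := by
  refine (norm_le_sum x).trans ((Finset.sum_le_sum fun i _ => h i).trans ?_)
  simp

/-- Powers of the Euler matrix contract the complement of the synchronous states. -/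
lemma exists_norm_kronAct_eulerMatrix_pow_le {l : Fin N → Fin N → ℝ} {v : Fin N → ℝ}
    (n : ℕ) (hl : ∀ i j, 0 ≤ l i j) (hgraph : ConnectedDigraph l) (hv : IsLeftEigenvector l v) :
    ∃ m : ℕ, ∀ e : Stack N n, ∑ i, v i • e i = 0 →
      ‖kronAct (eulerMatrix l ^ m) e‖ ≤ 1 / 2 * ‖e‖ := by
  have hN : (0 : ℝ) < N := by
    obtain ⟨root, -⟩ := hgraph
    exact_mod_cast root.pos
  -- One factor `N` pays for the sum over the columns, the other for passing from the units to the
  -- norm of the stack. The rank-one part `1 vᵀ` annihilates `e`, so only the deviation from it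
  -- counts.
  obtain ⟨m, hm⟩ := exists_eulerMatrix_pow_near hl hgraph hv
    (ε := 1 / (2 * (N * N))) (by positivity)
  refine ⟨m, fun e he => ?_⟩
  have hi : ∀ i, ‖kronAct (eulerMatrix l ^ m) e i‖ ≤ N * (1 / (2 * (N * N)) * ‖e‖) := by
    intro i
    have : kronAct (eulerMatrix l ^ m) e i
        = ∑ k, ((eulerMatrix l ^ m) i k - v k) • e k := by
      simp only [sub_smul, Finset.sum_sub_distrib, he, sub_zero, kronAct_apply]
    rw [this]
    refine (norm_sum_le _ _).trans ?_
    refine (Finset.sum_le_sum (g := fun _ => 1 / (2 * ((N : ℝ) * N)) * ‖e‖)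
      fun k _ => ?_).trans (by simp)
    rw [norm_smul]
    exact mul_le_mul (hm i k) (norm_apply_le e k) (norm_nonneg _) (by positivity)
  refine (norm_le_of_forall_norm_apply_le hi).trans (le_of_eq ?_)
  field_simp

/-- A quadratic Lyapunov function for the consensus dynamics `e' = - L e` on the complement of
the synchronous states. -/
lemma exists_consensus_lyapunov {l : Fin N → Fin N → ℝ} {v : Fin N → ℝ} (n : ℕ)
    (hl : ∀ i j, 0 ≤ l i j) (hgraph : ConnectedDigraph l) (hv : IsLeftEigenvector l v) :
    ∃ (W : Stack N n → ℝ) (D : Stack N n → Stack N n →L[ℝ] ℝ) (a b : ℝ), 0 < a ∧ 1 ≤ b ∧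
      (∀ x, HasFDerivAt W (D x) x) ∧ (∀ x y, |D x y| ≤ b * ‖x‖ * ‖y‖) ∧
      (∀ x, 0 ≤ W x ∧ W x ≤ b * ‖x‖ ^ 2) ∧
      (∀ e, ∑ i, v i • e i = 0 →
        ‖e‖ ^ 2 ≤ W e ∧ D e (-kronAct (laplacian l) e) ≤ -a * ‖e‖ ^ 2) := by
  obtain ⟨m, hm⟩ := exists_norm_kronAct_eulerMatrix_pow_le n hl hgraph hv
  set B : ℕ → Stack N n →L[ℝ] Stack N n := fun j => kronCLM n (eulerMatrix l ^ j) with hBdef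
  have hh := eulerStep_pos hl
  -- With `B = 1 - h L` one has `-L = (B - 1) / h`, and `2⟨p, q - p⟩ ≤ ‖q‖² - ‖p‖²`. The derivative
  -- of `∑ ‖B^j e‖²` along `-L e` therefore telescopes to at most `(‖B^m e‖² - ‖e‖²) / h ≤ -(3/4)
  -- ‖e‖² / h`.
  refine ⟨fun x => ∑ j ∈ Finset.range m, ‖B j x‖ ^ 2,
    fun x => ∑ j ∈ Finset.range m, (2 : ℕ) • (innerSL ℝ (B j x)).comp (B j),
    3 / 4 * (eulerStep l)⁻¹, 1 + ∑ j ∈ Finset.range m, 2 * ‖B j‖ ^ 2, by positivity,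
    le_add_of_nonneg_right (by positivity), ?_, ?_, ?_, ?_⟩
  · intro x
    refine HasFDerivAt.fun_sum fun j _ => ?_
    exact (B j).hasFDerivAt.norm_sq
  · intro x y
    have h1 : ∀ j, |((2 : ℕ) • (innerSL ℝ (B j x)).comp (B j)) y| ≤ 2 * ‖B j‖ ^ 2 * ‖x‖ * ‖y‖ := by
      intro j
      have h2 := abs_real_inner_le_norm (B j x) (B j y)
      have h3 := mul_le_mul ((B j).le_opNorm x) ((B j).le_opNorm y) (norm_nonneg _)
        (by positivity)
      simp only [_root_.smul_apply, ContinuousLinearMap.comp_apply,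
        innerSL_apply_apply, nsmul_eq_mul, Nat.cast_ofNat, abs_mul, abs_two]
      nlinarith
    rw [_root_.sum_apply]
    refine (Finset.abs_sum_le_sum_abs _ _).trans
      ((Finset.sum_le_sum fun j _ => h1 j).trans ?_)
    rw [← Finset.sum_mul, ← Finset.sum_mul, mul_assoc, mul_assoc]
    exact mul_le_mul_of_nonneg_right (by linarith) (by positivity)
  · intro x
    refine ⟨by positivity, ?_⟩
    have h1 : ∀ j, ‖B j x‖ ^ 2 ≤ 2 * ‖B j‖ ^ 2 * ‖x‖ ^ 2 := by
      intro j
      have := pow_le_pow_left₀ (norm_nonneg _) ((B j).le_opNorm x) 2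
      rw [mul_pow] at this
      nlinarith [sq_nonneg (‖B j‖ * ‖x‖)]
    refine (Finset.sum_le_sum fun j _ => h1 j).trans ?_
    rw [← Finset.sum_mul]
    exact mul_le_mul_of_nonneg_right (by linarith) (by positivity)
  · intro e he
    have hme := hm e he
    have h0 : B 0 e = e := by simp [hBdef, kronAct_one]
    refine ⟨?_, ?_⟩
    -- For `m = 0` the sum is empty, but then the contraction estimate itself forces `e = 0`.
    · rcases Nat.eq_zero_or_pos m with h | h
      · subst h
        have : ‖e‖ = 0 := by
          have h3 : ‖e‖ ≤ 1 / 2 * ‖e‖ := by simpa [kronAct_one] using hme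
          linarith [norm_nonneg e]
        simp [this]
      · have := Finset.single_le_sum (f := fun j => ‖B j e‖ ^ 2) (fun j _ => by positivity)
          (Finset.mem_range.2 h)
        simpa only [h0] using this
    · have hstep : ∀ j, B j (-kronAct (laplacian l) e)
          = (eulerStep l)⁻¹ • (B (j + 1) e - B j e) := by
        intro j
        have h1 : B (j + 1) e = B j (kronAct (eulerMatrix l) e) := by
          simp only [hBdef, kronCLM_apply, pow_succ, kronAct_mul]
        rw [h1, ← map_sub, kronAct_eulerMatrix, ← map_smul]
        congr 1
        rw [sub_sub_cancel_left, smul_neg, smul_smul, inv_mul_cancel₀ hh.ne', one_smul]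
      have hterm : ∀ j, ((2 : ℕ) • (innerSL ℝ (B j e)).comp (B j)) (-kronAct (laplacian l) e)
          ≤ (eulerStep l)⁻¹ * (‖B (j + 1) e‖ ^ 2 - ‖B j e‖ ^ 2) := by
        intro j
        have h2 : 2 * inner ℝ (B j e) (B (j + 1) e - B j e)
            ≤ ‖B (j + 1) e‖ ^ 2 - ‖B j e‖ ^ 2 := by
          have := norm_sub_sq_real (B (j + 1) e) (B j e)
          rw [inner_sub_right, real_inner_self_eq_norm_sq, real_inner_comm (B (j + 1) e)]
          nlinarith [sq_nonneg ‖B (j + 1) e - B j e‖]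
        simp only [_root_.smul_apply, ContinuousLinearMap.comp_apply,
          innerSL_apply_apply, nsmul_eq_mul, Nat.cast_ofNat, hstep, inner_smul_right]
        have := mul_le_mul_of_nonneg_left h2 (inv_pos.2 hh).le
        linarith
      rw [_root_.sum_apply]
      refine (Finset.sum_le_sum fun j _ => hterm j).trans ?_
      rw [← Finset.mul_sum, Finset.sum_range_sub (fun j => ‖B j e‖ ^ 2), h0]
      have h4 : ‖B m e‖ ^ 2 ≤ (1 / 2 * ‖e‖) ^ 2 := pow_le_pow_left₀ (norm_nonneg _) hme 2
      have h5 := mul_le_mul_of_nonneg_left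
        (show ‖B m e‖ ^ 2 - ‖e‖ ^ 2 ≤ -(3 / 4) * ‖e‖ ^ 2 by nlinarith) (inv_pos.2 hh).le
      linarith

end Stacks

/-! ### Autonomous differential equations -/

section ODE

lemma hasDerivWithinAt_Ici_of_Icc {F : Type*} [NormedAddCommGroup F] [NormedSpace ℝ F]
    {u : ℝ → F} {u' : F} {a b t : ℝ} (h : HasDerivWithinAt u u' (Icc a b) t)
    (ht : t ∈ Ico a b) : HasDerivWithinAt u u' (Ici t) t :=
  h.mono_of_mem_nhdsWithin (Icc_mem_nhdsGE_of_mem ht)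

/-- A barrier principle for finitely many functions: the maximum of the family does not increase
as long as it exceeds `K`. -/
lemma forall_le_of_deriv_nonpos_at_max {ι : Type*} [Finite ι] {u u' : ι → ℝ → ℝ} {a b K : ℝ}
    (hu : ∀ i, ∀ t ∈ Icc a b, HasDerivWithinAt (u i) (u' i t) (Icc a b) t)
    (h0 : ∀ i, u i a ≤ K)
    (hb : ∀ i, ∀ t ∈ Ico a b, (∀ j, u j t ≤ u i t) → K ≤ u i t → u' i t ≤ 0) :
    ∀ i, ∀ t ∈ Icc a b, u i t ≤ K := by
  -- The level is tilted by `ε * (t - a)`: a function touching it is maximal in the family, so its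
  -- slope is at most `0 < ε` and it cannot cross. Afterwards `ε` tends to `0`.
  have key : ∀ ε : ℝ, 0 < ε → Icc a b ⊆ {t | ∀ i, u i t ≤ K + ε * (t - a)} := by
    intro ε hε
    refine IsClosed.Icc_subset_of_forall_mem_nhdsGT_of_Icc_subset ?_ ?_ ?_
    · rcases isEmpty_or_nonempty ι with h | h
      · have : {t | ∀ i, u i t ≤ K + ε * (t - a)} = univ := by ext; simp
        rw [this, univ_inter]
        exact isClosed_Icc
      · have : {t | ∀ i, u i t ≤ K + ε * (t - a)} ∩ Icc a b
            = ⋂ i, Icc a b ∩ (fun t => u i t - (K + ε * (t - a))) ⁻¹' Iic 0 := by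
          ext t
          simp [forall_and, and_comm]
        rw [this]
        refine isClosed_iInter fun i => ContinuousOn.preimage_isClosed_of_isClosed ?_
          isClosed_Icc isClosed_Iic
        exact ContinuousOn.sub (fun t ht => (hu i t ht).continuousWithinAt)
          (Continuous.continuousOn (by fun_prop))
    · simpa using h0
    · intro t ht hsub
      have htm : ∀ j, u j t ≤ K + ε * (t - a) := hsub (right_mem_Icc.2 ht.1)
      rw [show {t | ∀ i, u i t ≤ K + ε * (t - a)} = ⋂ i, {t | u i t ≤ K + ε * (t - a)} by
        ext; simp, iInter_mem]
      intro i
      have hd : HasDerivWithinAt (fun s => u i s - (K + ε * (s - a))) (u' i t - ε) (Ioi t) t := by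
        have h1 := (hasDerivWithinAt_Ici_of_Icc (hu i t ⟨ht.1, ht.2.le⟩) ht).mono Ioi_subset_Ici_self
        have h2 : HasDerivWithinAt (fun s => K + ε * (s - a)) (ε * 1) (Ioi t) t :=
          (((hasDerivWithinAt_id t _).sub_const a).const_mul ε).const_add K
        simpa using h1.fun_sub h2
      rcases (htm i).lt_or_eq with hlt | heq
      · have : ∀ᶠ s in 𝓝[>] t, u i s - (K + ε * (s - a)) < 0 :=
          hd.continuousWithinAt.eventually (gt_mem_nhds (by linarith))
        filter_upwards [this] with s hs
        linarith
      · have hneg : u' i t - ε < 0 := by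
          have := hb i t ht (fun j => (htm j).trans heq.ge)
            (heq ▸ le_add_of_nonneg_right (mul_nonneg hε.le (sub_nonneg.2 ht.1)))
          linarith
        have hs := hd.limsup_slope_le' (by simp) hneg
        filter_upwards [hs, self_mem_nhdsWithin] with s hs hts
        rw [slope_def_field, heq, sub_self, sub_zero, div_neg_iff] at hs
        have : t < s := hts
        rcases hs with ⟨-, h⟩ | ⟨h, -⟩ <;> linarith
  intro i t ht
  refine le_of_forall_pos_le_add fun η hη => ?_
  have hpos : 0 < b - a + 1 := by linarith [ht.1, ht.2]
  refine (key (η / (b - a + 1)) (by positivity) ht i).trans ?_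
  have : η / (b - a + 1) * (t - a) ≤ η / (b - a + 1) * (b - a + 1) :=
    mul_le_mul_of_nonneg_left (by linarith [ht.2]) (by positivity)
  rw [div_mul_cancel₀ _ hpos.ne'] at this
  linarith

variable {E : Type*} [NormedAddCommGroup E] [NormedSpace ℝ E]

lemma IsSolution.continuousOn {g : E → E} {x : ℝ → E} (hx : IsSolution g x) :
    ContinuousOn x (Ici 0) := fun t ht => (hx t ht).continuousWithinAt

lemma IsSolution.hasDerivWithinAt_Icc {g : E → E} {x : ℝ → E} (hx : IsSolution g x) {a b t : ℝ}
    (ha : 0 ≤ a) (ht : t ∈ Icc a b) : HasDerivWithinAt x (g (x t)) (Icc a b) t :=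
  (hx t (ha.trans ht.1)).mono (Icc_subset_Ici_self.trans (Ici_subset_Ici.2 ha))

lemma IsSolution.hasDerivWithinAt_Ici {g : E → E} {x : ℝ → E} (hx : IsSolution g x) {t : ℝ}
    (ht : 0 ≤ t) : HasDerivWithinAt x (g (x t)) (Ici t) t :=
  (hx t ht).mono (Ici_subset_Ici.2 ht)

lemma IsSolution.hasDerivWithinAt_clm {F : Type*} [NormedAddCommGroup F] [NormedSpace ℝ F]
    {g : E → E} {x : ℝ → E} (hx : IsSolution g x) (p : E →L[ℝ] F) {t : ℝ} (ht : 0 ≤ t) :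
    HasDerivWithinAt (fun s => p (x s)) (p (g (x t))) (Ici 0) t :=
  p.hasFDerivAt.comp_hasDerivWithinAt t (hx t ht)

/-- The orbital derivative of a function of a linear image of the state. -/
lemma IsSolution.hasDerivWithinAt_comp_clm {F : Type*} [NormedAddCommGroup F] [NormedSpace ℝ F]
    {g : E → E} {x : ℝ → E} (hx : IsSolution g x) (p : E →L[ℝ] F) {W : F → ℝ} {W' : F →L[ℝ] ℝ}
    {t : ℝ} (hW : HasFDerivAt W W' (p (x t))) (ht : 0 ≤ t) :
    HasDerivWithinAt (fun s => W (p (x s))) (W' (p (g (x t)))) (Ici 0) t :=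
  hW.comp_hasDerivWithinAt t (hx.hasDerivWithinAt_clm p ht)

/-- Solutions of an autonomous equation may be shifted in time. -/
lemma IsSolution.shift {g : E → E} {x : ℝ → E} (hx : IsSolution g x) {a : ℝ} (ha : 0 ≤ a) :
    IsSolution g (fun t => x (a + t)) := by
  intro t ht
  have h := hx (a + t) (by positivity)
  have h2 : HasDerivWithinAt (fun t => a + t) 1 (Ici 0) t :=
    (hasDerivWithinAt_id t _).const_add a
  have := h.scomp t h2 (fun s hs => add_nonneg ha hs)
  simpa [Function.comp_def] using this

/-- Continuous dependence on the initial state. -/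
lemma norm_sub_le_of_isSolution {g : E → E} {s : Set E} {K : NNReal} (hg : LipschitzOnWith K g s)
    {x y : ℝ → E} (hx : IsSolution g x) (hy : IsSolution g y) (hxs : ∀ t, 0 ≤ t → x t ∈ s)
    (hys : ∀ t, 0 ≤ t → y t ∈ s) {t : ℝ} (ht : 0 ≤ t) :
    ‖x t - y t‖ ≤ ‖x 0 - y 0‖ * Real.exp (K * t) := by
  have := dist_le_of_trajectories_ODE_of_mem (v := fun _ => g) (s := fun _ => s) (K := K)
    (a := 0) (b := t) (f := x) (g := y) (δ := ‖x 0 - y 0‖) (fun _ _ => hg)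
    (hx.continuousOn.mono Icc_subset_Ici_self) (fun r hr => hx.hasDerivWithinAt_Ici hr.1)
    (fun r hr => hxs r hr.1) (hy.continuousOn.mono Icc_subset_Ici_self)
    (fun r hr => hy.hasDerivWithinAt_Ici hr.1) (fun r hr => hys r hr.1)
    (dist_eq_norm _ _).le t (right_mem_Icc.2 ht)
  rwa [dist_eq_norm, sub_zero] at this

/-- A bounded, globally Lipschitz vector field is forward complete. -/
lemma forwardComplete_of_lipschitzWith [CompleteSpace E] {g : E → E} {K L : NNReal}
    (hg : LipschitzWith K g) (hL : ∀ x, ‖g x‖ ≤ L) : ForwardComplete g := by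
  intro x₀
  have hloc : ∀ k : ℕ, ∃ y : ℝ → E, y 0 = x₀ ∧
      ∀ t ∈ Icc (0 : ℝ) k, HasDerivWithinAt y (g (y t)) (Icc 0 k) t := by
    intro k
    -- The bound `L` is global, so the ball of radius `L * k` confines the solution up to time `k`
    -- and no existence time is lost.
    have hp : IsPicardLindelof (fun _ => g) (⟨0, by simp⟩ : Icc (0 : ℝ) k) x₀
        (L * k) 0 L K :=
      { lipschitzOnWith := fun _ _ => hg.lipschitzOnWith
        continuousOn := fun _ _ => continuousOn_const
        norm_le := fun _ _ x _ => hL x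
        mul_max_le := by simp }
    exact hp.exists_eq_forall_mem_Icc_hasDerivWithinAt₀
  choose y hy0 hy using hloc
  have heq : ∀ j k : ℕ, j ≤ k → EqOn (y j) (y k) (Icc 0 j) := by
    intro j k hjk
    have hsub : Icc (0 : ℝ) j ⊆ Icc 0 k := Icc_subset_Icc_right (by exact_mod_cast hjk)
    have hd := fun t (ht : t ∈ Icc (0 : ℝ) j) => (hy k t (hsub ht)).mono hsub
    exact ODE_solution_unique_of_mem_Icc_right (v := fun _ => g) (s := fun _ => univ) (K := K)
      (fun _ _ => hg.lipschitzOnWith) (fun t ht => (hy j t ht).continuousWithinAt)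
      (fun t ht => hasDerivWithinAt_Ici_of_Icc (hy j t (Ico_subset_Icc_self ht)) ht) (fun _ _ => mem_univ _)
      (fun t ht => (hd t ht).continuousWithinAt)
      (fun t ht => hasDerivWithinAt_Ici_of_Icc (hd t (Ico_subset_Icc_self ht)) ht) (fun _ _ => mem_univ _)
      ((hy0 j).trans (hy0 k).symm)
  -- The index `⌊t⌋₊ + 1` keeps `t` away from the right end of the interval of the chosen solution.
  set x : ℝ → E := fun t => y (⌊t⌋₊ + 1) t with hxdef
  have hx : ∀ (k : ℕ), ∀ t ∈ Icc (0 : ℝ) k, x t = y k t := by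
    intro k t ht
    rcases le_total (⌊t⌋₊ + 1) k with h | h
    · exact heq _ _ h ⟨ht.1, by exact_mod_cast (Nat.lt_floor_add_one t).le⟩
    · exact (heq _ _ h ht).symm
  refine ⟨x, fun t ht => ?_, by rw [hx 0 0 (by simp), hy0]⟩
  have htk : t < ((⌊t⌋₊ + 1 : ℕ) : ℝ) := by exact_mod_cast Nat.lt_floor_add_one t
  have hmem : t ∈ Icc (0 : ℝ) ((⌊t⌋₊ + 1 : ℕ) : ℝ) := ⟨ht, htk.le⟩
  have h1 := (hy _ t hmem).congr (fun s hs => hx _ s hs) (hx _ t hmem)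
  rw [← hx _ t hmem] at h1
  refine h1.mono_of_mem_nhdsWithin ?_
  have : Ici (0 : ℝ) ∩ Iio ((⌊t⌋₊ + 1 : ℕ) : ℝ) ⊆ Icc 0 ((⌊t⌋₊ + 1 : ℕ) : ℝ) :=
    fun s hs => ⟨hs.1, hs.2.le⟩
  exact mem_of_superset (inter_mem_nhdsWithin _ (Iio_mem_nhds htk)) this

/-- A continuously differentiable vector field is forward complete if there are a priori bounds
for all equations obtained by multiplying it with a scalar function with values in `[0, 1]`. -/
lemma forwardComplete_of_bounded [FiniteDimensional ℝ E] {g : E → E} (hg : ContDiff ℝ 1 g)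
    (hb : ∀ x₀ : E, ∃ R : ℝ, ∀ (χ : E → ℝ) (y : ℝ → E), (∀ x, χ x ∈ Icc (0 : ℝ) 1) →
      IsSolution (fun x => χ x • g x) y → y 0 = x₀ → ∀ t, 0 ≤ t → ‖y t‖ ≤ R) :
    ForwardComplete g := by
  intro x₀
  obtain ⟨R, hR⟩ := hb x₀
  have : CompleteSpace E := FiniteDimensional.complete ℝ E
  have : ProperSpace E := FiniteDimensional.proper ℝ E
  -- The cut-off field is bounded and Lipschitz, hence complete. By the a priori bound its solution
  -- stays where the cut-off equals `1`, so it solves the original equation. The sign of `R` is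
  -- unknown, hence `|R|`.
  let χ : ContDiffBump (0 : E) := ⟨|R| + 1, |R| + 2, by positivity, by linarith⟩
  have hc : ContDiff ℝ 1 (fun x => χ x • g x) := χ.contDiff.smul hg
  have hs : HasCompactSupport (fun x => χ x • g x) := χ.hasCompactSupport.smul_right
  obtain ⟨K, hK⟩ := hc.lipschitzWith_of_hasCompactSupport hs one_ne_zero
  obtain ⟨C, hC⟩ := hs.exists_bound_of_continuous hc.continuous
  obtain ⟨y, hy, hy0⟩ := forwardComplete_of_lipschitzWith (L := C.toNNReal) hK
    (fun x => (hC x).trans (Real.le_coe_toNNReal C)) x₀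
  have hbd := hR χ y (fun x => ⟨χ.nonneg, χ.le_one⟩) hy hy0
  refine ⟨y, fun t ht => ?_, hy0⟩
  have h1 : χ (y t) = 1 := χ.one_of_mem_closedBall (by
    rw [mem_closedBall_zero_iff]
    exact (hbd t ht).trans ((le_abs_self R).trans (by simp [χ])))
  simpa [h1] using hy t ht

end ODE

/-! ### Lyapunov functions and functions of class `𝒦` -/

section Lyapunov

variable {E : Type*} [NormedAddCommGroup E] [NormedSpace ℝ E]

lemma antitoneOn_of_hasDerivWithinAt_Ici_nonpos {u u' : ℝ → ℝ} {a b : ℝ}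
    (hu : ∀ t ∈ Icc a b, HasDerivWithinAt u (u' t) (Icc a b) t)
    (h : ∀ t ∈ Icc a b, u' t ≤ 0) : AntitoneOn u (Icc a b) := by
  refine antitoneOn_of_deriv_nonpos (convex_Icc a b) (fun t ht => (hu t ht).continuousWithinAt)
    ?_ ?_
  · rw [interior_Icc]
    exact fun t ht => ((hu t (Ioo_subset_Icc_self ht)).hasDerivAt
      (Icc_mem_nhds ht.1 ht.2)).differentiableAt.differentiableWithinAt
  · rw [interior_Icc]
    intro t ht
    rw [((hu t (Ioo_subset_Icc_self ht)).hasDerivAt (Icc_mem_nhds ht.1 ht.2)).deriv]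
    exact h t (Ioo_subset_Icc_self ht)

lemma exists_pos_forall_le_of_isCompact {E : Type*} [TopologicalSpace E] {s : Set E} (hs : IsCompact s) {V : E → ℝ}
    (hV : ContinuousOn V s) (hpos : ∀ x ∈ s, 0 < V x) : ∃ μ : ℝ, 0 < μ ∧ ∀ x ∈ s, μ ≤ V x := by
  rcases s.eq_empty_or_nonempty with rfl | hne
  · exact ⟨1, one_pos, by simp⟩
  · obtain ⟨x, hx, h⟩ := hs.exists_isMinOn hne hV
    exact ⟨V x, hpos x hx, h⟩

/-- Lyapunov's theorem on stability: `V` is positive definite near the origin and `V'` is a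
nonpositive orbital derivative. -/
lemma stable_of_lyapunov [ProperSpace E] {g : E → E} {V V' : E → ℝ} {β : ℝ} (hβ : 0 < β)
    (hV : Continuous V) (hV0 : V 0 = 0) (hpos : ∀ x, x ≠ 0 → ‖x‖ ≤ β → 0 < V x)
    (hderiv : ∀ x : ℝ → E, IsSolution g x → ∀ t, 0 ≤ t →
      HasDerivWithinAt (fun s => V (x s)) (V' (x t)) (Ici 0) t)
    (hV' : ∀ x, ‖x‖ ≤ β → V' x ≤ 0) :
    ∀ η : ℝ, 0 < η → ∃ δ : ℝ, 0 < δ ∧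
      ∀ x : ℝ → E, IsSolution g x → ‖x 0‖ ≤ δ → ∀ t : ℝ, 0 ≤ t → ‖x t‖ ≤ η := by
  intro η₀ hη₀
  obtain ⟨η, hη, hηη₀, hηβ⟩ : ∃ η, 0 < η ∧ η ≤ η₀ ∧ η ≤ β :=
    ⟨min η₀ β, lt_min hη₀ hβ, min_le_left _ _, min_le_right _ _⟩
  obtain ⟨μ, hμ, hμV⟩ := exists_pos_forall_le_of_isCompact (isCompact_sphere (0 : E) η)
    hV.continuousOn (fun x hx => by
      rw [mem_sphere_zero_iff_norm] at hx
      exact hpos x (fun h => by simp [h] at hx; linarith) (hx.le.trans hηβ))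
  have hnear : ∀ᶠ x in 𝓝 (0 : E), V x < μ :=
    hV.continuousAt.eventually (gt_mem_nhds (by rwa [hV0]))
  obtain ⟨δ, hδ, hδV⟩ := Metric.eventually_nhds_iff.1 hnear
  refine ⟨min (δ / 2) (η / 2), by positivity, fun x hx hx0 t ht => ?_⟩
  have hVx0 : V (x 0) < μ := hδV (by
    rw [dist_zero_right]
    have := hx0.trans (min_le_left _ _)
    linarith)
  -- Continuous induction: `V` is known to decrease only while the solution is in the ball, and a
  -- value below `μ` keeps it off the sphere of radius `η`.
  have hsub : Icc 0 t ⊆ {s | ‖x s‖ ≤ η} := by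
    refine IsClosed.Icc_subset_of_forall_mem_nhdsGT_of_Icc_subset ?_ ?_ ?_
    · have : {s | ‖x s‖ ≤ η} ∩ Icc 0 t = Icc 0 t ∩ (fun s => ‖x s‖) ⁻¹' Iic η := by
        ext s; simp [and_comm]
      rw [this]
      exact (hx.continuousOn.mono Icc_subset_Ici_self).norm.preimage_isClosed_of_isClosed
        isClosed_Icc isClosed_Iic
    · have := hx0.trans (min_le_right _ _)
      change ‖x 0‖ ≤ η
      linarith
    · intro s hs hsub
      have hanti : AntitoneOn (fun r => V (x r)) (Icc 0 s) :=
        antitoneOn_of_hasDerivWithinAt_Ici_nonpos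
          (fun r hr => (hderiv x hx r hr.1).mono Icc_subset_Ici_self)
          (fun r hr => hV' _ ((hsub hr).trans hηβ))
      have h1 : V (x s) < μ :=
        (hanti (left_mem_Icc.2 hs.1) (right_mem_Icc.2 hs.1) hs.1).trans_lt hVx0
      have h2 : ‖x s‖ < η := lt_of_le_of_ne (hsub (right_mem_Icc.2 hs.1)) fun h =>
        absurd (hμV _ (mem_sphere_zero_iff_norm.2 h)) (not_le.2 h1)
      have h3 : ContinuousWithinAt (fun r => ‖x r‖) (Ioi s) s :=
        ((hx.continuousOn s hs.1).mono (fun r hr => hs.1.trans (le_of_lt hr))).norm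
      exact (h3.eventually (gt_mem_nhds h2)).mono fun r hr => le_of_lt hr
  exact (hsub (right_mem_Icc.2 ht)).trans hηη₀

/-- A bounded solution staying in a region where the orbital derivative of a positive definite
function is negative definite converges to the origin. -/
lemma tendsto_zero_of_lyapunov {E : Type*} [NormedAddCommGroup E] [ProperSpace E] {V V' q : E → ℝ} {β : ℝ}
    (hV : Continuous V) (hpos : ∀ x, x ≠ 0 → ‖x‖ ≤ β → 0 < V x) (hV0 : V 0 = 0)
    (hV' : ∀ x, ‖x‖ ≤ β → V' x ≤ -q x) (hq : Continuous q) (hq0 : ∀ x, 0 ≤ q x)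
    (hqpos : ∀ x, x ≠ 0 → ‖x‖ ≤ β → 0 < q x) {x : ℝ → E}
    (hderiv : ∀ t, 0 ≤ t → HasDerivWithinAt (fun s => V (x s)) (V' (x t)) (Ici 0) t)
    {T : ℝ} (hT : 0 ≤ T) (hball : ∀ t, T ≤ t → ‖x t‖ ≤ β) : Tendsto x atTop (𝓝 0) := by
  have hanti : ∀ s t, T ≤ s → s ≤ t → V (x t) ≤ V (x s) := by
    intro s t hs hst
    have hsub : Icc s t ⊆ Ici 0 := fun r hr => hT.trans (hs.trans hr.1)
    exact antitoneOn_of_hasDerivWithinAt_Ici_nonpos (u' := fun r => V' (x r))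
      (fun r hr => (hderiv r (hsub hr)).mono hsub)
      (fun r hr => (hV' _ (hball r (hs.trans hr.1))).trans (neg_nonpos.2 (hq0 _)))
      (left_mem_Icc.2 hst) (right_mem_Icc.2 hst) hst
  rw [Metric.tendsto_atTop]
  intro η hη
  have hK : IsCompact (Metric.closedBall (0 : E) β ∩ {y | η ≤ ‖y‖}) :=
    (isCompact_closedBall _ _).inter_right (isClosed_le continuous_const continuous_norm)
  obtain ⟨μ, hμ, hμV⟩ := exists_pos_forall_le_of_isCompact hK hV.continuousOn (fun y hy => by
    refine hpos y (fun h => ?_) (mem_closedBall_zero_iff.1 hy.1)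
    have : η ≤ ‖y‖ := hy.2
    simp [h] at this
    linarith)
  -- If `V` stayed above `μ`, the solution would remain in a compact set avoiding `0`, where `q ≥ m
  -- > 0`. Then `V` would be used up by the time `T + V (x T) / m`.
  have hexists : ∃ s, T ≤ s ∧ V (x s) < μ := by
    by_contra! hcon
    have hK2 : IsCompact (Metric.closedBall (0 : E) β ∩ {y | μ ≤ V y}) :=
      (isCompact_closedBall _ _).inter_right (isClosed_le continuous_const hV)
    obtain ⟨m, hm, hmq⟩ := exists_pos_forall_le_of_isCompact hK2 hq.continuousOn (fun y hy => by
      refine hqpos y (fun h => ?_) (mem_closedBall_zero_iff.1 hy.1)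
      have : μ ≤ V y := hy.2
      rw [h, hV0] at this
      linarith)
    have hlin : ∀ t, T ≤ t → V (x t) + m * t ≤ V (x T) + m * T := by
      intro t ht
      have hsub : Icc T t ⊆ Ici 0 := fun r hr => hT.trans hr.1
      exact antitoneOn_of_hasDerivWithinAt_Ici_nonpos (u := fun r => V (x r) + m * r)
        (u' := fun r => V' (x r) + m * 1)
        (fun r hr => ((hderiv r (hsub hr)).mono hsub).add
          ((hasDerivWithinAt_id r _).const_mul m))
        (fun r hr => by
          have h1 := hV' _ (hball r hr.1)
          have h2 := hmq (x r) ⟨mem_closedBall_zero_iff.2 (hball r hr.1), hcon r hr.1⟩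
          linarith)
        (left_mem_Icc.2 ht) (right_mem_Icc.2 ht) ht
    have h3 := hcon T le_rfl
    have h4 := hlin (T + V (x T) / m) (le_add_of_nonneg_right (div_nonneg (hμ.le.trans h3) hm.le))
    have h5 := hcon (T + V (x T) / m) (le_add_of_nonneg_right (div_nonneg (hμ.le.trans h3) hm.le))
    rw [mul_add, mul_div_cancel₀ _ hm.ne'] at h4
    linarith
  obtain ⟨s, hs, hsμ⟩ := hexists
  refine ⟨s, fun t ht => ?_⟩
  rw [dist_zero_right]
  by_contra! h
  have := hμV (x t) ⟨mem_closedBall_zero_iff.2 (hball t (hs.trans ht)), h⟩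
  have := hanti s t hs ht
  linarith

/-- Every nondecreasing function vanishing continuously at `0` is dominated by a function of
class `𝒦`. -/
lemma exists_classK_ge {ω : ℝ → ℝ} (hmono : Monotone ω) (h0 : ω 0 = 0)
    (hcont : ContinuousAt ω 0) (hneg : ∀ s ≤ 0, ω s = 0) (c : ℝ) (hc : 0 < c) :
    ∃ κ : ℝ → ℝ, ClassK κ ∧ ∀ s, 0 ≤ s → ω s + c * s ≤ κ s := by
  have hint : ∀ a b : ℝ, IntervalIntegrable ω MeasureTheory.volume a b :=
    fun a b => hmono.intervalIntegrable
  have hint' : ∀ s : ℝ, 0 ≤ s → ∀ a b : ℝ,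
      IntervalIntegrable (fun τ => ω (s * τ)) MeasureTheory.volume a b :=
    fun s hs a b => (hmono.comp (monotone_mul_left_of_nonneg hs)).intervalIntegrable
  have hnonneg : ∀ s, 0 ≤ ω s := fun s => by
    rcases le_total s 0 with h | h
    · exact (hneg s h).ge
    · exact h0 ▸ hmono h
  -- For `s > 0` this is the average of `ω` over `[s, 2s]`: monotonicity puts it above `ω s`, and it
  -- is continuous as a difference of primitives divided by `s`. The linear term makes it strictly
  -- increasing.
  set I : ℝ → ℝ := fun s => ∫ τ in (1 : ℝ)..2, ω (s * τ) with hI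
  have hIge : ∀ s, 0 ≤ s → ω s ≤ I s := by
    intro s hs
    have := intervalIntegral.integral_mono_on (a := 1) (b := 2) (f := fun _ => ω s)
      (g := fun τ => ω (s * τ)) (by norm_num) (by simp) (hint' s hs 1 2)
      (fun τ hτ => hmono (le_mul_of_one_le_right hs hτ.1))
    simpa [show (2 : ℝ) - 1 = 1 by norm_num] using this
  have hImono : ∀ s t, 0 ≤ s → s ≤ t → I s ≤ I t := by
    intro s t hs hst
    exact intervalIntegral.integral_mono_on (by norm_num) (hint' s hs 1 2)
      (hint' t (hs.trans hst) 1 2)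
      (fun τ hτ => hmono (mul_le_mul_of_nonneg_right hst (by linarith [hτ.1])))
  have hI0 : I 0 = 0 := by simp [hI, h0]
  have hIcont : ContinuousOn I (Ici 0) := by
    intro s hs
    rcases (show (0 : ℝ) ≤ s from hs).eq_or_lt with rfl | hs
    · refine ContinuousAt.continuousWithinAt ?_
      have hlim : Tendsto (fun s : ℝ => ω (2 * |s|)) (𝓝 0) (𝓝 0) := by
        have h1 : Tendsto (fun s : ℝ => 2 * |s|) (𝓝 0) (𝓝 0) := by
          have : Continuous fun s : ℝ => 2 * |s| := by fun_prop
          simpa using this.tendsto 0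
        have h2 : Tendsto ω (𝓝 0) (𝓝 0) := by simpa [ContinuousAt, h0] using hcont
        exact h2.comp h1
      rw [ContinuousAt, hI0]
      refine squeeze_zero_norm (fun s => ?_) hlim
      have := intervalIntegral.norm_integral_le_of_norm_le_const (a := 1) (b := 2)
        (f := fun τ => ω (s * τ)) (C := ω (2 * |s|)) (fun τ hτ => by
          rw [uIoc_of_le (by norm_num)] at hτ
          rw [Real.norm_of_nonneg (hnonneg _)]
          refine hmono ?_
          have : s * τ ≤ |s| * τ := mul_le_mul_of_nonneg_right (le_abs_self s) (by linarith [hτ.1])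
          nlinarith [hτ.2, abs_nonneg s])
      simpa [show (2 : ℝ) - 1 = 1 by norm_num] using this
    · have hprim := intervalIntegral.continuous_primitive hint 0
      have heq : ∀ᶠ r in 𝓝 s, I r
          = r⁻¹ * ((∫ τ in (0 : ℝ)..(r * 2), ω τ) - ∫ τ in (0 : ℝ)..r, ω τ) := by
        filter_upwards [lt_mem_nhds hs] with r hr
        rw [hI]
        simp only
        rw [intervalIntegral.integral_comp_mul_left _ hr.ne', mul_one, smul_eq_mul,
          intervalIntegral.integral_interval_sub_left (hint _ _) (hint _ _)]
      refine ContinuousAt.continuousWithinAt (ContinuousAt.congr ?_ (EventuallyEq.symm heq))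
      refine (continuousAt_inv₀ hs.ne').mul (Continuous.continuousAt ?_)
      exact (hprim.comp (continuous_id.mul continuous_const)).sub hprim
  refine ⟨fun s => I s + c * s, ⟨hIcont.add (Continuous.continuousOn (by fun_prop)), ?_, ?_⟩, ?_⟩
  · intro s hs t ht hst
    have := hImono s t hs hst.le
    have := mul_lt_mul_of_pos_left hst hc
    change I s + c * s < I t + c * t
    linarith
  · simp [hI0]
  · intro s hs
    have := hIge s hs
    linarith

end Lyapunov

/-! ### Invariance and ultimate boundedness of the network -/

section Network

variable {N n : ℕ}

/-- Semi-passivity for all inputs forces the storage function to have gradient `x`, so that the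
field points inwards on large spheres. -/
lemma StrictlySemiPassive.exists_inner_nonpos {f : Vec n → Vec n} (hf : StrictlySemiPassive f) :
    ∃ ρ : ℝ, 0 < ρ ∧ ∀ x : Vec n, ρ ≤ ‖x‖ → inner ℝ x (f x) ≤ 0 := by
  obtain ⟨W, ρ, H, ψ, -, -, -, hρ, -, -, hψ, hdiss, hH⟩ := hf
  refine ⟨ρ, hρ, fun x hx => ?_⟩
  have hgrad : ∀ u, fderiv ℝ W x u = inner ℝ x u := by
    intro u
    by_contra hne
    have hne' : fderiv ℝ W x u - inner ℝ x u ≠ 0 := sub_ne_zero.2 hne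
    -- For the input `λ u` dissipation reads `λ (W'(x) u - ⟨x, u⟩) ≤ C`, with `C` independent of
    -- `λ`. The chosen `λ` makes the left side equal to `C + 1`.
    set C := -H x - fderiv ℝ W x (f x)
    have h := hdiss x (((C + 1) / (fderiv ℝ W x u - inner ℝ x u)) • u)
    rw [map_add, map_smul, inner_smul_right, smul_eq_mul] at h
    have h2 : (C + 1) / (fderiv ℝ W x u - inner ℝ x u) * (fderiv ℝ W x u - inner ℝ x u) = C + 1 :=
      div_mul_cancel₀ _ hne'
    rw [mul_sub] at h2
    simp only [C] at *
    linarith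
  have h := hdiss x 0
  rw [add_zero, inner_zero_right, hgrad] at h
  linarith [hψ ‖x‖, hH x hx]

lemma exists_common_inner_nonpos {f : Fin N → Vec n → Vec n}
    (hpass : ∀ i, StrictlySemiPassive (f i)) :
    ∃ ρ : ℝ, 0 < ρ ∧ ∀ i x, ρ ≤ ‖x‖ → inner ℝ x (f i x) ≤ 0 := by
  choose ρ hρ h using fun i => (hpass i).exists_inner_nonpos
  have hle : ∀ i, ρ i ≤ ∑ i, ρ i := fun i =>
    Finset.single_le_sum (f := ρ) (fun j _ => (hρ j).le) (Finset.mem_univ i)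
  exact ⟨1 + ∑ i, ρ i, add_pos_of_pos_of_nonneg one_pos (Finset.sum_nonneg fun i _ => (hρ i).le),
    fun i x hx => h i x (by linarith [hle i])⟩

lemma networkField_apply (l : Fin N → Fin N → ℝ) (f : Fin N → Vec n → Vec n) (σ : ℝ)
    (x : Stack N n) (i : Fin N) :
    networkField l f σ x i = f i (x i) - σ • ∑ j, l i j • (x i - x j) := by
  simp only [networkField, PiLp.sub_apply, PiLp.smul_apply, kronAct_apply, stackedField,
    sum_laplacian_smul]

lemma contDiff_stackedField {f : Fin N → Vec n → Vec n} (hf : ∀ i, ContDiff ℝ 1 (f i)) :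
    ContDiff ℝ 1 (stackedField f) := by
  rw [contDiff_piLp]
  exact fun i => (hf i).comp (PiLp.proj (𝕜 := ℝ) 2 (fun _ : Fin N => Vec n) i).contDiff

lemma contDiff_networkField (l : Fin N → Fin N → ℝ) {f : Fin N → Vec n → Vec n}
    (hf : ∀ i, ContDiff ℝ 1 (f i)) (σ : ℝ) : ContDiff ℝ 1 (networkField l f σ) :=
  (contDiff_stackedField hf).sub ((kronCLM n (laplacian l)).contDiff.const_smul σ)

/-- The projection to the state of a unit. -/
noncomputable def unitCLM (i : Fin N) : Stack N n →L[ℝ] Vec n :=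
  PiLp.proj 2 (fun _ : Fin N => Vec n) i

lemma IsSolution.hasDerivWithinAt_apply {g : Stack N n → Stack N n} {x : ℝ → Stack N n}
    (hx : IsSolution g x) (i : Fin N) {t : ℝ} (ht : 0 ≤ t) :
    HasDerivWithinAt (fun s => x s i) (g (x t) i) (Ici 0) t :=
  hx.hasDerivWithinAt_clm (unitCLM i) ht

/-- The maximal norm of the states of the units. -/
noncomputable def maxNorm (x : Stack N n) : ℝ := ‖WithLp.ofLp x‖

lemma maxNorm_nonneg (x : Stack N n) : 0 ≤ maxNorm x := norm_nonneg _

lemma norm_apply_le_maxNorm (x : Stack N n) (i : Fin N) : ‖x i‖ ≤ maxNorm x :=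
  norm_le_pi_norm (WithLp.ofLp x) i

lemma maxNorm_le {x : Stack N n} {R : ℝ} (hR : 0 ≤ R) (h : ∀ i, ‖x i‖ ≤ R) : maxNorm x ≤ R :=
  (pi_norm_le_iff_of_nonneg hR).2 h

lemma maxNorm_le_norm (x : Stack N n) : maxNorm x ≤ ‖x‖ :=
  maxNorm_le (norm_nonneg x) (norm_apply_le x)

lemma norm_le_maxNorm (x : Stack N n) : ‖x‖ ≤ N * maxNorm x :=
  norm_le_of_forall_norm_apply_le (norm_apply_le_maxNorm x)

lemma continuous_maxNorm : Continuous (maxNorm : Stack N n → ℝ) :=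
  (PiLp.continuous_ofLp 2 (fun _ : Fin N => Vec n)).norm

/-- By Cauchy–Schwarz the coupling never pushes a unit of maximal norm outwards. No symmetry of the
weights is needed, which is why the maximal norm is the right quantity for a directed graph. -/
lemma inner_coupling_nonneg {x : Stack N n} {i j : Fin N} (h : ‖x j‖ ≤ ‖x i‖) :
    0 ≤ inner ℝ (x i) (x i - x j) := by
  rw [inner_sub_right, real_inner_self_eq_norm_sq]
  nlinarith [real_inner_le_norm (x i) (x j), norm_nonneg (x i)]

lemma inner_networkField (l : Fin N → Fin N → ℝ) (f : Fin N → Vec n → Vec n) (σ : ℝ)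
    (x : Stack N n) (i : Fin N) : inner ℝ (x i) (networkField l f σ x i)
      = inner ℝ (x i) (f i (x i)) - σ * ∑ j, l i j * inner ℝ (x i) (x i - x j) := by
  rw [networkField_apply, inner_sub_right, inner_smul_right, inner_sum]
  simp only [inner_smul_right]

/-- The sets on which all units have norm at most `R` are forward invariant for `R ≥ ρ`. -/
lemma maxNorm_le_of_isSolution_smul {l : Fin N → Fin N → ℝ} {f : Fin N → Vec n → Vec n}
    (hl : ∀ i j, 0 ≤ l i j) {ρ : ℝ} (hρ : 0 < ρ)
    (hf : ∀ i x, ρ ≤ ‖x‖ → inner ℝ x (f i x) ≤ 0) {σ : ℝ} (hσ : 0 ≤ σ)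
    {χ : Stack N n → ℝ} (hχ : ∀ x, 0 ≤ χ x) {x : ℝ → Stack N n}
    (hx : IsSolution (fun x => χ x • networkField l f σ x) x) {R : ℝ} (hR : ρ ≤ R)
    (h0 : maxNorm (x 0) ≤ R) {t : ℝ} (ht : 0 ≤ t) : maxNorm (x t) ≤ R := by
  have hR0 : 0 ≤ R := hρ.le.trans hR
  have key := forall_le_of_deriv_nonpos_at_max (a := 0) (b := t) (K := R ^ 2)
    (u := fun i s => ‖x s i‖ ^ 2)
    (u' := fun i s => 2 * inner ℝ (x s i) ((χ (x s) • networkField l f σ (x s)) i))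
    (fun i s hs => ((hx.hasDerivWithinAt_apply i hs.1).mono Icc_subset_Ici_self).norm_sq)
    (fun i => pow_le_pow_left₀ (norm_nonneg _) ((norm_apply_le_maxNorm _ i).trans h0) 2) ?_
  · exact maxNorm_le hR0 fun i => le_of_sq_le_sq (key i t (right_mem_Icc.2 ht)) hR0
  · intro i s hs hmax hge
    have h1 : ρ ≤ ‖x s i‖ := hR.trans (le_of_sq_le_sq hge (norm_nonneg _))
    have h2 : ∀ j, ‖x s j‖ ≤ ‖x s i‖ := fun j => le_of_sq_le_sq (hmax j) (norm_nonneg _)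
    have h3 : 0 ≤ ∑ j, l i j * inner ℝ (x s i) (x s i - x s j) :=
      Finset.sum_nonneg fun j _ => mul_nonneg (hl i j) (inner_coupling_nonneg (h2 j))
    rw [PiLp.smul_apply, inner_smul_right, inner_networkField]
    have h4 := hf i _ h1
    have h5 : χ (x s) * (inner ℝ (x s i) (f i (x s i)) -
        σ * ∑ j, l i j * inner ℝ (x s i) (x s i - x s j)) ≤ 0 :=
      mul_nonpos_of_nonneg_of_nonpos (hχ _) (by linarith [mul_nonneg hσ h3])
    linarith

lemma maxNorm_le_of_isSolution {l : Fin N → Fin N → ℝ} {f : Fin N → Vec n → Vec n}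
    (hl : ∀ i j, 0 ≤ l i j) {ρ : ℝ} (hρ : 0 < ρ)
    (hf : ∀ i x, ρ ≤ ‖x‖ → inner ℝ x (f i x) ≤ 0) {σ : ℝ} (hσ : 0 ≤ σ) {x : ℝ → Stack N n}
    (hx : IsSolution (networkField l f σ) x) {R : ℝ} (hR : ρ ≤ R)
    (h0 : maxNorm (x 0) ≤ R) {t : ℝ} (ht : 0 ≤ t) : maxNorm (x t) ≤ R :=
  maxNorm_le_of_isSolution_smul hl hρ hf hσ (χ := fun _ => 1) (fun _ => zero_le_one)
    (by simpa using hx) hR h0 ht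

/-- Multiplication by a nonnegative scalar does not affect the inward direction, so the invariant
sets bound all cut-off equations by the same constant. -/
lemma forwardComplete_networkField {l : Fin N → Fin N → ℝ} {f : Fin N → Vec n → Vec n}
    (hl : ∀ i j, 0 ≤ l i j) (hC : ∀ i, ContDiff ℝ 1 (f i)) {ρ : ℝ} (hρ : 0 < ρ)
    (hf : ∀ i x, ρ ≤ ‖x‖ → inner ℝ x (f i x) ≤ 0) {σ : ℝ} (hσ : 0 ≤ σ) :
    ForwardComplete (networkField l f σ) := by
  refine forwardComplete_of_bounded (contDiff_networkField l hC σ) fun x₀ =>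
    ⟨N * max ρ (maxNorm x₀), fun χ y hχ hy hy0 t ht => (norm_le_maxNorm _).trans ?_⟩
  refine mul_le_mul_of_nonneg_left ?_ (Nat.cast_nonneg N)
  exact maxNorm_le_of_isSolution_smul hl hρ hf hσ (fun x => (hχ x).1) hy (le_max_left _ _)
    (by rw [hy0]; exact le_max_right _ _) ht

/-- A unit that is strictly inside the maximal sphere stays strictly inside. -/
lemma norm_apply_lt_of_isSolution {l : Fin N → Fin N → ℝ} {f : Fin N → Vec n → Vec n}
    (hl : ∀ i j, 0 ≤ l i j) {ρ : ℝ} (hρ : 0 < ρ)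
    (hf : ∀ i x, ρ ≤ ‖x‖ → inner ℝ x (f i x) ≤ 0) {σ : ℝ} (hσ : 0 ≤ σ) {y : ℝ → Stack N n}
    (hy : IsSolution (networkField l f σ) y) {R : ℝ} (hR : ρ < R)
    (hmax : ∀ t, 0 ≤ t → maxNorm (y t) ≤ R) {i : Fin N} {a : ℝ} (ha : 0 ≤ a)
    (hlt : ‖y a i‖ < R) {t : ℝ} (hat : a ≤ t) : ‖y t i‖ < R := by
  have hR0 : 0 < R := hρ.trans hR
  set S : ℝ := ∑ j, l i j with hS
  have hS0 : 0 ≤ S := Finset.sum_nonneg fun j _ => hl i j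
  -- The barrier is `R² - w` with `w = c exp(-C (s - a))`. On it `⟨y_i, y_i - y_j⟩ ≥ -w`, so
  -- `‖y_i‖²` has slope at most `2 σ S w < C w`, the slope of the barrier. The choice of `c` makes
  -- the barrier start above `‖y a i‖²` and stay above `ρ²`.
  set C : ℝ := 2 * (σ * S) + 1 with hC
  have hC0 : 0 < C := by positivity
  set c : ℝ := min (R ^ 2 - ‖y a i‖ ^ 2) (R ^ 2 - ρ ^ 2) with hc
  have hc0 : 0 < c := lt_min (by nlinarith [norm_nonneg (y a i)]) (by nlinarith)
  have key := image_le_of_deriv_right_lt_deriv_boundary (a := a) (b := t)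
    (f := fun s => ‖y s i‖ ^ 2)
    (f' := fun s => 2 * inner ℝ (y s i) (networkField l f σ (y s) i))
    (B := fun s => R ^ 2 - c * Real.exp (-C * (s - a)))
    (B' := fun s => -(c * (Real.exp (-C * (s - a)) * (-C * 1))))
    (fun s hs => (((hy.hasDerivWithinAt_apply i (ha.trans hs.1)).mono
      (fun r hr => ha.trans hr.1)).norm_sq).continuousWithinAt)
    (fun s hs => ((hy.hasDerivWithinAt_apply i (ha.trans hs.1)).mono
      (Ici_subset_Ici.2 (ha.trans hs.1))).norm_sq)
    ?_ (fun s => ((((hasDerivAt_id s).sub_const a).const_mul (-C)).exp.const_mul c).const_sub _)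
    ?_ (right_mem_Icc.2 hat)
  · have hexp := Real.exp_pos (-C * (t - a))
    have : ‖y t i‖ ^ 2 < R ^ 2 := by
      have := mul_pos hc0 hexp
      simp only at key
      linarith
    exact lt_of_pow_lt_pow_left₀ 2 hR0.le this
  · simp only [sub_self, mul_zero, Real.exp_zero, mul_one]
    linarith [min_le_left (R ^ 2 - ‖y a i‖ ^ 2) (R ^ 2 - ρ ^ 2)]
  · intro s hs heq
    simp only at heq ⊢
    have hs0 : 0 ≤ s := ha.trans hs.1
    set w : ℝ := c * Real.exp (-C * (s - a)) with hw
    have hw0 : 0 < w := mul_pos hc0 (Real.exp_pos _)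
    have hwc : w ≤ c := by
      refine mul_le_of_le_one_right hc0.le (Real.exp_le_one_iff.2 ?_)
      nlinarith [hs.1]
    have hρs : ρ ≤ ‖y s i‖ := by
      refine le_of_sq_le_sq ?_ (norm_nonneg _)
      rw [heq]
      linarith [min_le_right (R ^ 2 - ‖y a i‖ ^ 2) (R ^ 2 - ρ ^ 2)]
    have hle : ∀ j, ‖y s j‖ ≤ R := fun j => (norm_apply_le_maxNorm _ j).trans (hmax s hs0)
    have hterm : ∀ j, l i j * (-w) ≤ l i j * inner ℝ (y s i) (y s i - y s j) := by
      intro j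
      refine mul_le_mul_of_nonneg_left ?_ (hl i j)
      have h1 : inner ℝ (y s i) (y s j) ≤ ‖y s i‖ * R :=
        (real_inner_le_norm _ _).trans (mul_le_mul_of_nonneg_left (hle j) (norm_nonneg _))
      rw [inner_sub_right, real_inner_self_eq_norm_sq]
      nlinarith [hle i, norm_nonneg (y s i)]
    have hsum : S * (-w) ≤ ∑ j, l i j * inner ℝ (y s i) (y s i - y s j) := by
      rw [hS, Finset.sum_mul]
      exact Finset.sum_le_sum fun j _ => hterm j
    rw [inner_networkField]
    have h2 := hf i _ hρs
    have h3 := mul_le_mul_of_nonneg_left hsum hσ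
    have h4 : -(c * (Real.exp (-C * (s - a)) * (-C * 1))) = C * w := by rw [hw]; ring
    rw [h4, hC]
    nlinarith

end Network

/-! ### LaSalle argument: absorption into a ball independent of the coupling strength -/

section LaSalle

variable {N n : ℕ}

lemma exists_norm_apply_eq_maxNorm [Nonempty (Fin N)] (x : Stack N n) :
    ∃ i, ‖x i‖ = maxNorm x := by
  obtain ⟨i, hi⟩ := Finite.exists_max fun i => ‖x i‖
  exact ⟨i, le_antisymm (norm_apply_le_maxNorm x i) (maxNorm_le (norm_nonneg _) hi)⟩

/-- If a unit stays on the maximal sphere, its in-neighbours coincide with it. -/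
lemma apply_eq_of_norm_apply_eq {l : Fin N → Fin N → ℝ} {f : Fin N → Vec n → Vec n}
    (hl : ∀ i j, 0 ≤ l i j) {ρ : ℝ}
    (hf : ∀ i x, ρ ≤ ‖x‖ → inner ℝ x (f i x) ≤ 0) {σ : ℝ} (hσ : 0 < σ) {y : ℝ → Stack N n}
    (hy : IsSolution (networkField l f σ) y) {R : ℝ} (hR : ρ ≤ R)
    (hmax : ∀ t, 0 ≤ t → maxNorm (y t) = R) {i : Fin N} (hi : ∀ t, 0 ≤ t → ‖y t i‖ = R)
    {j : Fin N} (hij : 0 < l i j) {t : ℝ} (ht : 0 ≤ t) : y t j = y t i := by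
  have hd1 := (hy.hasDerivWithinAt_apply i ht).norm_sq
  have hd2 : HasDerivWithinAt (fun s => ‖y s i‖ ^ 2) 0 (Ici 0) t :=
    (hasDerivWithinAt_const t (Ici 0) (R ^ 2)).congr (fun s hs => by rw [hi s hs])
      (by rw [hi t ht])
  -- The squared norm is constant, and its derivative is a sum of nonpositive contributions, so each
  -- of them vanishes. Together with `‖y_j‖ ≤ ‖y_i‖`, orthogonality of `y_i` and `y_i - y_j` forces
  -- equality.
  have h0 : 2 * inner ℝ (y t i) (networkField l f σ (y t) i) = 0 :=
    (uniqueDiffOn_Ici (0 : ℝ) t ht).eq_deriv _ hd1 hd2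
  rw [inner_networkField] at h0
  have hle : ∀ k, ‖y t k‖ ≤ ‖y t i‖ := fun k => by
    rw [hi t ht, ← hmax t ht]; exact norm_apply_le_maxNorm _ k
  have hnn : ∀ k ∈ Finset.univ, 0 ≤ l i k * inner ℝ (y t i) (y t i - y t k) := fun k _ =>
    mul_nonneg (hl i k) (inner_coupling_nonneg (hle k))
  have h1 := hf i (y t i) (hR.trans (hi t ht).ge)
  have h2 : ∑ k, l i k * inner ℝ (y t i) (y t i - y t k) ≤ 0 := by
    by_contra! h
    have := mul_pos hσ h
    linarith
  have h3 := (Finset.sum_eq_zero_iff_of_nonneg hnn).1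
    (le_antisymm h2 (Finset.sum_nonneg hnn)) j (Finset.mem_univ j)
  have h4 : inner ℝ (y t i) (y t i - y t j) = 0 := (mul_eq_zero.1 h3).resolve_left hij.ne'
  rw [inner_sub_right, real_inner_self_eq_norm_sq] at h4
  have h5 := norm_sub_sq_real (y t i) (y t j)
  have h6 : ‖y t j‖ ^ 2 ≤ ‖y t i‖ ^ 2 := pow_le_pow_left₀ (norm_nonneg _) (hle j) 2
  have h7 : ‖y t i - y t j‖ ^ 2 ≤ 0 := by linarith
  have h8 : ‖y t i - y t j‖ = 0 := by nlinarith [norm_nonneg (y t i - y t j)]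
  exact (sub_eq_zero.1 (norm_eq_zero.1 h8)).symm

/-- There is no solution on which the maximal norm is a constant larger than `ρ`. -/
lemma not_forall_maxNorm_eq {l : Fin N → Fin N → ℝ} {f : Fin N → Vec n → Vec n}
    {v : Fin N → ℝ} (hl : ∀ i j, 0 ≤ l i j) (hgraph : ConnectedDigraph l)
    (hv : IsLeftEigenvector l v) (hred : GloballyAsymptoticallyStable (reducedField f v))
    {ρ : ℝ} (hρ : 0 < ρ) (hf : ∀ i x, ρ ≤ ‖x‖ → inner ℝ x (f i x) ≤ 0) {σ : ℝ} (hσ : 0 < σ)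
    {y : ℝ → Stack N n} (hy : IsSolution (networkField l f σ) y) {R : ℝ} (hR : ρ < R) :
    ¬ ∀ t, 0 ≤ t → maxNorm (y t) = R := by
  intro hmax
  have hne : Nonempty (Fin N) := ⟨hgraph.choose⟩
  -- Otherwise every unit is strictly inside at some time `a i` and remains so; at time `∑ i, a i`
  -- no unit would attain the maximum.
  obtain ⟨i, hi⟩ : ∃ i, ∀ t, 0 ≤ t → ‖y t i‖ = R := by
    by_contra! hcon
    choose a ha hane using hcon
    have hlt : ∀ i, ‖y (a i) i‖ < R := fun i =>
      lt_of_le_of_ne ((norm_apply_le_maxNorm _ i).trans (hmax _ (ha i)).le) (hane i)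
    have hS : 0 ≤ ∑ i, a i := Finset.sum_nonneg fun i _ => ha i
    obtain ⟨i, hi⟩ := exists_norm_apply_eq_maxNorm (y (∑ i, a i))
    have := norm_apply_lt_of_isSolution hl hρ hf hσ.le hy hR (fun t ht => (hmax t ht).le) (ha i)
      (hlt i) (Finset.single_le_sum (f := a) (fun j _ => ha j) (Finset.mem_univ i))
    rw [hi, hmax _ hS] at this
    exact lt_irrefl _ this
  -- `J` is closed under in-neighbours, so it carries `v`, and all coupling terms within it vanish.
  -- Averaging the equations of its members with the weights `v` yields the reduced equation.
  let J : Set (Fin N) := {j | ∀ t, 0 ≤ t → y t j = y t i}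
  have hclosed : ∀ j ∈ J, ∀ k, 0 < l j k → k ∈ J := by
    intro j hj k hjk t ht
    rw [apply_eq_of_norm_apply_eq hl hf hσ hy hR.le hmax
      (fun s hs => by rw [hj s hs, hi s hs]) hjk ht, hj t ht]
  have hv0 : ∀ j, j ∉ J → v j = 0 := fun j hj =>
    hv.eq_zero_of_notMem hl hgraph ⟨i, show i ∈ J from fun _ _ => rfl⟩ hclosed hj
  have hfield : ∀ j ∈ J, ∀ t, 0 ≤ t → networkField l f σ (y t) j = f j (y t i) := by
    intro j hj t ht
    rw [networkField_apply, Finset.sum_eq_zero, smul_zero, sub_zero, hj t ht]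
    intro k _
    rcases (hl j k).eq_or_lt with h | h
    · rw [← h, zero_smul]
    · rw [hclosed j hj k h t ht, hj t ht, sub_self, smul_zero]
  have hz : IsSolution (reducedField f v) (fun t => y t i) := by
    intro t ht
    have hsum : HasDerivWithinAt (fun s => ∑ j, v j • y s i) (∑ j, v j • f j (y t i)) (Ici 0) t := by
      refine HasDerivWithinAt.fun_sum fun j _ => ?_
      by_cases hj : j ∈ J
      · have h1 := hy.hasDerivWithinAt_apply j ht
        rw [hfield j hj t ht] at h1
        exact (h1.congr (fun s hs => (hj s hs).symm) (hj t ht).symm).const_smul (v j)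
      · simpa [hv0 j hj] using hasDerivWithinAt_const t (Ici 0) (0 : Vec n)
    simp only [← Finset.sum_smul, hv.sum_eq_one, one_smul] at hsum
    exact hsum
  have hlim := (hred.attractive _ hz).norm
  rw [norm_zero] at hlim
  have hconst : Tendsto (fun t => ‖y t i‖) atTop (𝓝 R) :=
    tendsto_const_nhds.congr' ((eventually_ge_atTop 0).mono fun t ht => (hi t ht).symm)
  linarith [tendsto_nhds_unique hlim hconst]

/-- Every solution enters the set on which all units have norm at most `R`, for `R > ρ`. -/
lemma exists_maxNorm_le {l : Fin N → Fin N → ℝ} {f : Fin N → Vec n → Vec n}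
    {v : Fin N → ℝ} (hl : ∀ i j, 0 ≤ l i j) (hgraph : ConnectedDigraph l)
    (hC : ∀ i, ContDiff ℝ 1 (f i))
    (hv : IsLeftEigenvector l v) (hred : GloballyAsymptoticallyStable (reducedField f v))
    {ρ : ℝ} (hρ : 0 < ρ) (hf : ∀ i x, ρ ≤ ‖x‖ → inner ℝ x (f i x) ≤ 0) {σ : ℝ} (hσ : 0 < σ)
    {x : ℝ → Stack N n} (hx : IsSolution (networkField l f σ) x) {R₀ : ℝ} (hR₀ : ρ < R₀) :
    ∃ T, 0 ≤ T ∧ ∀ t, T ≤ t → maxNorm (x t) ≤ R₀ := by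
  by_contra! hcon
  have hshift : ∀ {s t : ℝ}, 0 ≤ s → s ≤ t → ∀ {R : ℝ}, ρ ≤ R → maxNorm (x s) ≤ R →
      maxNorm (x t) ≤ R := by
    intro s t hs hst R hR h
    have := maxNorm_le_of_isSolution hl hρ hf hσ.le (hx.shift hs) hR (by simpa using h)
      (sub_nonneg.2 hst)
    simpa using this
  have hlow : ∀ t, 0 ≤ t → R₀ < maxNorm (x t) := by
    intro t ht
    obtain ⟨s, hts, hs⟩ := hcon t ht
    exact lt_of_not_ge fun h => not_lt.2 (hshift ht hts hR₀.le h) hs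
  have hanti : ∀ s t, 0 ≤ s → s ≤ t → maxNorm (x t) ≤ maxNorm (x s) := fun s t hs hst =>
    hshift hs hst (hR₀.trans (hlow s hs)).le le_rfl
  -- The maximal norm decreases to some `R ≥ R₀ > ρ`. The solution `y` through an accumulation point
  -- of `x k` is a limit of time shifts of `x`, so its maximal norm is constantly `R`.
  set a : ℕ → ℝ := fun k => maxNorm (x k) with ha
  have haanti : Antitone a := fun j k hjk =>
    hanti _ _ (Nat.cast_nonneg j) (by exact_mod_cast hjk)
  have hbdd : BddBelow (range a) := ⟨0, by rintro _ ⟨k, rfl⟩; exact maxNorm_nonneg _⟩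
  have hlim := tendsto_atTop_ciInf haanti hbdd
  set R := ⨅ k, a k with hR
  have hRR₀ : R₀ ≤ R := le_ciInf fun k => (hlow k (Nat.cast_nonneg k)).le
  have hRle : ∀ t, 0 ≤ t → R ≤ maxNorm (x t) := fun t ht =>
    (ciInf_le hbdd ⌈t⌉₊).trans (hanti _ _ ht (Nat.le_ceil t))
  have hM0 : ∀ t, 0 ≤ t → ‖x t‖ ≤ N * a 0 := fun t ht =>
    (norm_le_maxNorm _).trans (mul_le_mul_of_nonneg_left
      (by simpa [ha] using hanti 0 t le_rfl ht) (Nat.cast_nonneg N))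
  obtain ⟨y₀, -, φ, hφ, hy₀⟩ := (isCompact_closedBall (0 : Stack N n) (N * a 0)).tendsto_subseq
    (x := fun k : ℕ => x k)
    (fun k => mem_closedBall_zero_iff.2 (hM0 k (Nat.cast_nonneg k)))
  obtain ⟨y, hy, hy0⟩ := forwardComplete_networkField hl hC hρ hf hσ.le y₀
  have hRlim : Tendsto (fun k => a (φ k)) atTop (𝓝 R) := hlim.comp hφ.tendsto_atTop
  have hy₀R : maxNorm y₀ = R :=
    tendsto_nhds_unique ((continuous_maxNorm.tendsto y₀).comp hy₀) hRlim
  have hRa0 : R ≤ a 0 := ciInf_le hbdd 0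
  have hyM : ∀ t, 0 ≤ t → ‖y t‖ ≤ N * a 0 := fun t ht =>
    (norm_le_maxNorm _).trans (mul_le_mul_of_nonneg_left
      ((maxNorm_le_of_isSolution hl hρ hf hσ.le hy (hR₀.le.trans hRR₀)
        (by rw [hy0, hy₀R]) ht).trans hRa0) (Nat.cast_nonneg N))
  obtain ⟨K, hK⟩ := (contDiff_networkField l hC σ).contDiffOn.exists_lipschitzOnWith
    one_ne_zero (convex_closedBall (0 : Stack N n) (N * a 0)) (isCompact_closedBall _ _)
  refine not_forall_maxNorm_eq hl hgraph hv hred hρ hf hσ hy (hR₀.trans_le hRR₀) fun t ht => ?_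
  have hconv : Tendsto (fun k => x (φ k + t)) atTop (𝓝 (y t)) := by
    rw [tendsto_iff_norm_sub_tendsto_zero]
    have h1 : Tendsto (fun k => ‖x (φ k) - y₀‖ * Real.exp (K * t)) atTop (𝓝 0) := by
      have := (tendsto_iff_norm_sub_tendsto_zero.1 hy₀).mul_const (Real.exp (K * t))
      simpa using this
    refine squeeze_zero (fun k => norm_nonneg _) (fun k => ?_) h1
    have := norm_sub_le_of_isSolution hK (hx.shift (Nat.cast_nonneg (φ k))) hy
      (fun s hs => mem_closedBall_zero_iff.2 (hM0 _ (by positivity)))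
      (fun s hs => mem_closedBall_zero_iff.2 (hyM s hs)) ht
    simpa [hy0] using this
  have h2 : Tendsto (fun k => maxNorm (x (φ k + t))) atTop (𝓝 (maxNorm (y t))) :=
    (continuous_maxNorm.tendsto _).comp hconv
  have h3 : Tendsto (fun k => maxNorm (x (φ k + t))) atTop (𝓝 R) :=
    tendsto_of_tendsto_of_tendsto_of_le_of_le tendsto_const_nhds hRlim
      (fun k => hRle _ (by positivity))
      (fun k => hanti _ _ (Nat.cast_nonneg _) (le_add_of_nonneg_right ht))
  exact tendsto_nhds_unique h2 h3

end LaSalle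

/-! ### Uniform estimates for globally asymptotically stable equations -/

section UniformStability

variable {E : Type*} [NormedAddCommGroup E] [NormedSpace ℝ E]

/-- The largest norm reached by solutions starting in the closed ball of radius `s`. -/
noncomputable def overshoot (g : E → E) (s : ℝ) : ℝ :=
  sSup {r | ∃ z : ℝ → E, IsSolution g z ∧ ‖z 0‖ ≤ s ∧ ∃ t, 0 ≤ t ∧ r = ‖z t‖}

lemma overshoot_nonneg (g : E → E) (s : ℝ) : 0 ≤ overshoot g s := by
  refine Real.sSup_nonneg ?_
  rintro _ ⟨z, -, -, t, -, rfl⟩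
  exact norm_nonneg _

lemma norm_le_overshoot {g : E → E} {ρ : ℝ}
    (hinv : ∀ R, ρ ≤ R → ∀ z, IsSolution g z → ‖z 0‖ ≤ R → ∀ t, 0 ≤ t → ‖z t‖ ≤ R)
    {z : ℝ → E} (hz : IsSolution g z) {s : ℝ} (hs : ‖z 0‖ ≤ s) {t : ℝ} (ht : 0 ≤ t) :
    ‖z t‖ ≤ overshoot g s := by
  refine le_csSup ⟨max ρ s, ?_⟩ ⟨z, hz, hs, t, ht, rfl⟩
  rintro _ ⟨y, hy, hys, r, hr, rfl⟩
  exact hinv _ (le_max_left _ _) y hy (hys.trans (le_max_right _ _)) r hr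

lemma monotone_overshoot {g : E → E} {ρ : ℝ}
    (hinv : ∀ R, ρ ≤ R → ∀ z, IsSolution g z → ‖z 0‖ ≤ R → ∀ t, 0 ≤ t → ‖z t‖ ≤ R) :
    Monotone (overshoot g) := by
  intro s s' hss'
  refine Real.sSup_le ?_ (overshoot_nonneg g s')
  rintro _ ⟨z, hz, hzs, t, ht, rfl⟩
  exact norm_le_overshoot hinv hz (hzs.trans hss') ht

/-- A bound of class `𝒦` on the solutions. -/
lemma GloballyAsymptoticallyStable.exists_classK {g : E → E}
    (hg : GloballyAsymptoticallyStable g) {ρ : ℝ}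
    (hinv : ∀ R, ρ ≤ R → ∀ z, IsSolution g z → ‖z 0‖ ≤ R → ∀ t, 0 ≤ t → ‖z t‖ ≤ R)
    {A c : ℝ} (hA : 0 ≤ A) (hc : 0 < c) :
    ∃ κ : ℝ → ℝ, ClassK κ ∧ ∀ z, IsSolution g z → ∀ s, ‖z 0‖ ≤ s → ∀ t, 0 ≤ t →
      A * ‖z t‖ + c * s ≤ κ s := by
  have hsmall : ∀ η : ℝ, 0 < η → ∃ δ : ℝ, 0 < δ ∧ ∀ s ≤ δ, overshoot g s ≤ η := by
    intro η hη
    obtain ⟨δ, hδ, h⟩ := hg.stable η hη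
    refine ⟨δ, hδ, fun s hs => Real.sSup_le ?_ hη.le⟩
    rintro _ ⟨z, hz, hzs, t, ht, rfl⟩
    exact h z hz (hzs.trans hs) t ht
  -- For `s < 0` the supremum is over the empty set and has the default value `0`; for `s = 0`
  -- Lyapunov stability is used.
  have hneg : ∀ s ≤ 0, overshoot g s = 0 := fun s hs =>
    le_antisymm (le_of_forall_pos_le_add fun η hη => by
      obtain ⟨δ, hδ, h⟩ := hsmall η hη
      simpa using h s (hs.trans hδ.le)) (overshoot_nonneg g s)
  have hcont : ContinuousAt (overshoot g) 0 := by
    rw [Metric.continuousAt_iff]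
    intro η hη
    obtain ⟨δ, hδ, h⟩ := hsmall (η / 2) (half_pos hη)
    refine ⟨δ, hδ, fun {s} hs => ?_⟩
    rw [hneg 0 le_rfl, Real.dist_eq, sub_zero, abs_of_nonneg (overshoot_nonneg g s)]
    rw [Real.dist_eq, sub_zero] at hs
    linarith [h s ((le_abs_self s).trans hs.le)]
  obtain ⟨κ, hκ, hle⟩ := exists_classK_ge (ω := fun s => A * overshoot g s)
    ((monotone_overshoot hinv).const_mul hA) (by simp [hneg]) (hcont.const_mul A)
    (fun s hs => by simp [hneg s hs]) c hc
  refine ⟨κ, hκ, fun z hz s hs t ht => le_trans ?_ (hle s ((norm_nonneg _).trans hs))⟩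
  have := mul_le_mul_of_nonneg_left (norm_le_overshoot hinv hz hs ht) hA
  linarith

/-- Attraction to the origin is uniform on bounded sets. -/
lemma GloballyAsymptoticallyStable.exists_uniform_time [FiniteDimensional ℝ E] {g : E → E}
    (hg : GloballyAsymptoticallyStable g) (hC : ContDiff ℝ 1 g) {ρ : ℝ}
    (hinv : ∀ R, ρ ≤ R → ∀ z, IsSolution g z → ‖z 0‖ ≤ R → ∀ t, 0 ≤ t → ‖z t‖ ≤ R)
    {R : ℝ} (hR : ρ ≤ R) {β : ℝ} (hβ : 0 < β) :
    ∃ T, 0 ≤ T ∧ ∀ z, IsSolution g z → ‖z 0‖ ≤ R → ∀ t, T ≤ t → ‖z t‖ ≤ β := by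
  have : ProperSpace E := FiniteDimensional.proper ℝ E
  obtain ⟨δ, hδ, hstab⟩ := hg.stable β hβ
  obtain ⟨K, hK⟩ := hC.contDiffOn.exists_lipschitzOnWith one_ne_zero
    (convex_closedBall (0 : E) R) (isCompact_closedBall _ _)
  have hball : ∀ {z}, IsSolution g z → ‖z 0‖ ≤ R → ∀ t, 0 ≤ t → z t ∈ Metric.closedBall (0 : E) R :=
    fun {z} hz h t ht => mem_closedBall_zero_iff.2 (hinv R hR z hz h t ht)
  have key : ∃ T, 0 ≤ T ∧ ∀ z, IsSolution g z → ‖z 0‖ ≤ R → z 0 ∈ Metric.closedBall (0 : E) R →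
      ∀ t, T ≤ t → ‖z t‖ ≤ β := by
    -- Near each initial state, continuous dependence brings all solutions into the `δ`-ball at a
    -- common time `τ`, and stability keeps them in the `β`-ball. Compactness makes the time
    -- uniform.
    refine (isCompact_closedBall (0 : E) R).induction_on
      (p := fun s => ∃ T, 0 ≤ T ∧ ∀ z, IsSolution g z → ‖z 0‖ ≤ R → z 0 ∈ s →
        ∀ t, T ≤ t → ‖z t‖ ≤ β) ⟨0, le_rfl, by simp⟩ ?_ ?_ ?_
    · rintro s s' hss' ⟨T, hT, h⟩
      exact ⟨T, hT, fun z hz hzR hzs => h z hz hzR (hss' hzs)⟩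
    · rintro s s' ⟨T, hT, h⟩ ⟨T', hT', h'⟩
      refine ⟨max T T', hT.trans (le_max_left _ _), fun z hz hzR hzs t ht => ?_⟩
      rcases hzs with hzs | hzs
      · exact h z hz hzR hzs t ((le_max_left _ _).trans ht)
      · exact h' z hz hzR hzs t ((le_max_right _ _).trans ht)
    · intro y₀ hy₀
      obtain ⟨y, hy, rfl⟩ := hg.complete y₀
      have hev := (hg.attractive y hy).norm
      rw [norm_zero] at hev
      obtain ⟨τ, hτ, hτ0⟩ := ((hev.eventually (gt_mem_nhds (half_pos hδ))).and
        (eventually_ge_atTop 0)).exists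
      refine ⟨Metric.ball (y 0) (δ / 2 * Real.exp (-(K * τ))),
        mem_nhdsWithin_of_mem_nhds (Metric.ball_mem_nhds _ (by positivity)), τ, hτ0,
        fun z hz hzR hzs t ht => ?_⟩
      have h1 := norm_sub_le_of_isSolution hK hz hy (hball hz hzR)
        (hball hy (mem_closedBall_zero_iff.1 hy₀)) hτ0
      rw [Metric.mem_ball, dist_eq_norm] at hzs
      have h2 : ‖z 0 - y 0‖ * Real.exp (K * τ) ≤ δ / 2 := by
        have := mul_le_mul_of_nonneg_right hzs.le (Real.exp_pos (K * τ)).le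
        rwa [mul_assoc, ← Real.exp_add, neg_add_cancel, Real.exp_zero, mul_one] at this
      have h3 : ‖z τ‖ ≤ δ := by
        have := norm_le_norm_add_norm_sub' (z τ) (y τ)
        linarith
      have := hstab _ (hz.shift hτ0) (by simpa using h3) (t - τ) (sub_nonneg.2 ht)
      simpa using this
  obtain ⟨T, hT, h⟩ := key
  exact ⟨T, hT, fun z hz hzR => h z hz hzR (mem_closedBall_zero_iff.2 hzR)⟩

lemma gronwallBound_le {δ K ε x : ℝ} (hK : 1 ≤ K) (hε : 0 ≤ ε) :
    gronwallBound δ K ε x ≤ (δ + ε) * Real.exp (K * x) := by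
  rw [gronwallBound_of_K_ne_0 (by linarith)]
  have h1 : ε / K ≤ ε := div_le_self hε hK
  have h2 := Real.exp_pos (K * x)
  have h3 : 0 ≤ ε / K := div_nonneg hε (by linarith)
  nlinarith [mul_le_mul_of_nonneg_right h1 h2.le]

end UniformStability

/-! ### Mean-field state and synchronization error -/

section MeanError

variable {N n : ℕ}

/-- The mean-field state `x_m = ∑ᵢ vᵢ xᵢ`. -/
noncomputable def meanCLM (n : ℕ) (v : Fin N → ℝ) : Stack N n →L[ℝ] Vec n where
  toFun x := ∑ i, v i • x i
  map_add' x y := by simp [Finset.sum_add_distrib]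
  map_smul' c x := by simp [Finset.smul_sum, smul_comm c]
  cont := continuous_finsetSum _ fun i _ =>
    (PiLp.continuous_apply 2 (fun _ : Fin N => Vec n) i).const_smul (v i)

/-- The synchronization error `e = x - 1 ⊗ x_m`. -/
noncomputable def errCLM (n : ℕ) (v : Fin N → ℝ) : Stack N n →L[ℝ] Stack N n :=
  kronCLM n (1 - Matrix.vecMulVec (fun _ => 1) v)

lemma meanCLM_apply (v : Fin N → ℝ) (x : Stack N n) : meanCLM n v x = ∑ i, v i • x i := rfl

lemma errCLM_apply (v : Fin N → ℝ) (x : Stack N n) (i : Fin N) :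
    errCLM n v x i = x i - meanCLM n v x := by
  simp [errCLM, meanCLM_apply, Matrix.vecMulVec_apply, sub_smul, Finset.sum_sub_distrib,
    Matrix.one_apply]

lemma errCLM_add_diagStack (v : Fin N → ℝ) (x : Stack N n) :
    errCLM n v x + diagStack (meanCLM n v x) = x := by
  ext i : 1
  simp [errCLM_apply, diagStack]

lemma sum_smul_errCLM {v : Fin N → ℝ} (hv : ∑ i, v i = 1) (x : Stack N n) :
    ∑ i, v i • errCLM n v x i = 0 := by
  simp only [errCLM_apply, smul_sub, Finset.sum_sub_distrib, ← Finset.sum_smul, hv, one_smul]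
  rw [meanCLM_apply, sub_self]

lemma norm_diagStack_le (y : Vec n) : ‖(diagStack y : Stack N n)‖ ≤ N * ‖y‖ :=
  norm_le_of_forall_norm_apply_le fun _ => le_rfl

lemma norm_le_mean_add_err (v : Fin N → ℝ) (x : Stack N n) :
    ‖x‖ ≤ N * ‖meanCLM n v x‖ + ‖errCLM n v x‖ := by
  conv_lhs => rw [← errCLM_add_diagStack v x]
  have := norm_add_le (errCLM n v x) (diagStack (meanCLM n v x))
  linarith [norm_diagStack_le (N := N) (meanCLM n v x)]

lemma norm_meanCLM_le_maxNorm {v : Fin N → ℝ} (hv0 : ∀ i, 0 ≤ v i) (hv : ∑ i, v i = 1)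
    (x : Stack N n) : ‖meanCLM n v x‖ ≤ maxNorm x := by
  rw [meanCLM_apply]
  refine (norm_sum_le _ _).trans ?_
  refine (Finset.sum_le_sum (g := fun i => v i * maxNorm x) fun i _ => ?_).trans_eq
    (by rw [← Finset.sum_mul, hv, one_mul])
  rw [norm_smul, Real.norm_of_nonneg (hv0 i)]
  exact mul_le_mul_of_nonneg_left (norm_apply_le_maxNorm x i) (hv0 i)

lemma norm_errCLM_le {v : Fin N → ℝ} (hv0 : ∀ i, 0 ≤ v i) (hv : ∑ i, v i = 1)
    (x : Stack N n) : ‖errCLM n v x‖ ≤ (1 + N) * ‖x‖ := by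
  have h1 : errCLM n v x = x - diagStack (meanCLM n v x) :=
    eq_sub_of_add_eq (errCLM_add_diagStack v x)
  have h2 := norm_sub_le x (diagStack (meanCLM n v x))
  have h3 : (N : ℝ) * ‖meanCLM n v x‖ ≤ N * ‖x‖ := mul_le_mul_of_nonneg_left
    ((norm_meanCLM_le_maxNorm hv0 hv x).trans (maxNorm_le_norm x)) (Nat.cast_nonneg N)
  rw [h1]
  linarith [norm_diagStack_le (N := N) (meanCLM n v x)]

/-- The coupling is invisible to the mean field because `vᵀ L = 0`. -/
lemma meanCLM_networkField {l : Fin N → Fin N → ℝ} {v : Fin N → ℝ}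
    (hv : IsLeftEigenvector l v) (f : Fin N → Vec n → Vec n) (σ : ℝ) (x : Stack N n) :
    meanCLM n v (networkField l f σ x) = meanCLM n v (stackedField f x) := by
  have h : meanCLM n v (kronAct (laplacian l) x) = 0 := by
    simp only [meanCLM_apply, kronAct_apply, Finset.smul_sum, smul_smul]
    rw [Finset.sum_comm]
    refine Finset.sum_eq_zero fun j _ => ?_
    rw [← Finset.sum_smul]
    have : ∑ i, v i * laplacian l i j = 0 := congrFun hv.null j
    rw [this, zero_smul]
  rw [networkField, map_sub, map_smul, h, smul_zero, sub_zero]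

/-- The projection `1 - 1 vᵀ` commutes with `L`, since `L 1 = 0` and `vᵀ L = 0`. -/
lemma errCLM_networkField {l : Fin N → Fin N → ℝ} {v : Fin N → ℝ}
    (hv : IsLeftEigenvector l v) (f : Fin N → Vec n → Vec n) (σ : ℝ) (x : Stack N n) :
    errCLM n v (networkField l f σ x)
      = errCLM n v (stackedField f x) - σ • kronAct (laplacian l) (errCLM n v x) := by
  have h : errCLM n v (kronAct (laplacian l) x) = kronAct (laplacian l) (errCLM n v x) := by
    rw [errCLM, kronCLM_apply, kronCLM_apply, ← kronAct_mul, ← kronAct_mul, sub_mul, mul_sub,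
      one_mul, mul_one, Matrix.vecMulVec_mul, Matrix.mul_vecMulVec, hv.null]
    have : laplacian l *ᵥ (fun _ => 1) = 0 := by
      ext i
      simp [Matrix.mulVec, dotProduct, sum_laplacian]
    simp [this]
  rw [networkField, map_sub, map_smul, h]

lemma contDiff_reducedField {f : Fin N → Vec n → Vec n} (hC : ∀ i, ContDiff ℝ 1 (f i))
    (v : Fin N → ℝ) : ContDiff ℝ 1 (reducedField f v) :=
  ContDiff.sum fun i _ => (hC i).const_smul (v i)

/-- As `v ≥ 0`, the reduced field inherits from the units that it does not point outwards beyond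
`ρ`. -/
lemma norm_le_of_isSolution_reducedField {f : Fin N → Vec n → Vec n} {v : Fin N → ℝ}
    (hv0 : ∀ i, 0 ≤ v i) {ρ : ℝ} (hρ : 0 < ρ)
    (hf : ∀ i x, ρ ≤ ‖x‖ → inner ℝ x (f i x) ≤ 0) (R : ℝ) (hR : ρ ≤ R) (z : ℝ → Vec n)
    (hz : IsSolution (reducedField f v) z) (h0 : ‖z 0‖ ≤ R) (t : ℝ) (ht : 0 ≤ t) :
    ‖z t‖ ≤ R := by
  have hR0 : 0 ≤ R := hρ.le.trans hR
  have key := forall_le_of_deriv_nonpos_at_max (ι := Unit) (a := 0) (b := t) (K := R ^ 2)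
    (u := fun _ s => ‖z s‖ ^ 2) (u' := fun _ s => 2 * inner ℝ (z s) (reducedField f v (z s)))
    (fun _ s hs => (hz.hasDerivWithinAt_Icc le_rfl hs).norm_sq)
    (fun _ => pow_le_pow_left₀ (norm_nonneg _) h0 2) ?_
  · exact le_of_sq_le_sq (key () t (right_mem_Icc.2 ht)) hR0
  · intro _ s _ _ hge
    have h1 : ρ ≤ ‖z s‖ := hR.trans (le_of_sq_le_sq hge (norm_nonneg _))
    rw [reducedField, inner_sum]
    refine mul_nonpos_of_nonneg_of_nonpos zero_le_two (Finset.sum_nonpos fun i _ => ?_)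
    rw [inner_smul_right]
    exact mul_nonpos_of_nonneg_of_nonpos (hv0 i) (hf i _ h1)

/-- The mean field is a convex combination of the units, so it lies in the same ball, where each `f
i` is Lipschitz, and `x_i - x_m = e_i`. -/
lemma exists_lipschitz_mean {f : Fin N → Vec n → Vec n} (hC : ∀ i, ContDiff ℝ 1 (f i))
    {v : Fin N → ℝ} (hv0 : ∀ i, 0 ≤ v i) (hv : ∑ i, v i = 1) (R : ℝ) :
    ∃ C : ℝ, 0 ≤ C ∧ ∀ x : Stack N n, maxNorm x ≤ R →
      ‖meanCLM n v (stackedField f x) - reducedField f v (meanCLM n v x)‖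
        ≤ C * ‖errCLM n v x‖ := by
  choose K hK using fun i => (hC i).contDiffOn.exists_lipschitzOnWith one_ne_zero
    (convex_closedBall (0 : Vec n) R) (isCompact_closedBall _ _)
  refine ⟨∑ i, v i * K i, Finset.sum_nonneg fun i _ => mul_nonneg (hv0 i) (K i).2,
    fun x hx => ?_⟩
  rw [meanCLM_apply v (stackedField f x), reducedField, ← Finset.sum_sub_distrib, Finset.sum_mul]
  refine (norm_sum_le _ _).trans (Finset.sum_le_sum fun i _ => ?_)
  rw [← smul_sub, norm_smul, Real.norm_of_nonneg (hv0 i), mul_assoc]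
  refine mul_le_mul_of_nonneg_left ?_ (hv0 i)
  have h1 := (hK i).dist_le_mul (x i)
    (mem_closedBall_zero_iff.2 ((norm_apply_le_maxNorm x i).trans hx)) (meanCLM n v x)
    (mem_closedBall_zero_iff.2 ((norm_meanCLM_le_maxNorm hv0 hv x).trans hx))
  rw [dist_eq_norm, dist_eq_norm, ← errCLM_apply] at h1
  exact h1.trans (mul_le_mul_of_nonneg_left (norm_apply_le _ i) (K i).2)

lemma exists_bound_of_maxNorm_le {F : Type*} [NormedAddCommGroup F] {φ : Stack N n → F}
    (hφ : Continuous φ) (R : ℝ) : ∃ C : ℝ, 0 ≤ C ∧ ∀ x, maxNorm x ≤ R → ‖φ x‖ ≤ C := by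
  obtain ⟨C, hC⟩ := (isCompact_closedBall (0 : Stack N n) (N * R)).exists_bound_of_continuousOn
    hφ.continuousOn
  refine ⟨max C 0, le_max_right _ _, fun x hx => (hC x ?_).trans (le_max_left _ _)⟩
  exact mem_closedBall_zero_iff.2 ((norm_le_maxNorm x).trans
    (mul_le_mul_of_nonneg_left hx (Nat.cast_nonneg N)))

end MeanError

/-! ### Strong coupling: practical stability -/

section StrongCoupling

variable {N n : ℕ}

/-- The coupling strength enters only through the negative quadratic term; this is the source of the
separation of time scales. -/
lemma errCLM_orbital_deriv_le {l : Fin N → Fin N → ℝ} {f : Fin N → Vec n → Vec n}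
    {v : Fin N → ℝ} (hv : IsLeftEigenvector l v) {D : Stack N n → Stack N n →L[ℝ] ℝ} {a b : ℝ}
    (hD : ∀ x y, |D x y| ≤ b * ‖x‖ * ‖y‖)
    (hDL : ∀ e : Stack N n, ∑ i, v i • e i = 0 →
      D e (-kronAct (laplacian l) e) ≤ -a * ‖e‖ ^ 2) {σ : ℝ} (hσ : 0 ≤ σ) (x : Stack N n) :
    D (errCLM n v x) (errCLM n v (networkField l f σ x))
      ≤ b * ‖errCLM n v x‖ * ‖errCLM n v (stackedField f x)‖
        - σ * a * ‖errCLM n v x‖ ^ 2 := by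
  rw [errCLM_networkField hv, sub_eq_add_neg, ← smul_neg, map_add, map_smul, smul_eq_mul]
  have h1 := (le_abs_self _).trans (hD (errCLM n v x) (errCLM n v (stackedField f x)))
  have h2 := mul_le_mul_of_nonneg_left
    (hDL (errCLM n v x) (sum_smul_errCLM hv.sum_eq_one x)) hσ
  linarith

/-- The Lyapunov function of the synchronization error stays below any level beyond which it
decreases. -/
lemma errCLM_lyapunov_le_max {l : Fin N → Fin N → ℝ} {f : Fin N → Vec n → Vec n}
    {v : Fin N → ℝ} (hv : IsLeftEigenvector l v) {W : Stack N n → ℝ}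
    {D : Stack N n → Stack N n →L[ℝ] ℝ} {a b : ℝ} (ha : 0 < a) (hb : 1 ≤ b)
    (hW : ∀ x, HasFDerivAt W (D x) x) (hD : ∀ x y, |D x y| ≤ b * ‖x‖ * ‖y‖)
    (hWb : ∀ x, W x ≤ b * ‖x‖ ^ 2)
    (hDL : ∀ e : Stack N n, ∑ i, v i • e i = 0 →
      D e (-kronAct (laplacian l) e) ≤ -a * ‖e‖ ^ 2) {σ : ℝ} (hσ : 0 ≤ σ)
    {x : ℝ → Stack N n} (hx : IsSolution (networkField l f σ) x) {C : ℝ}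
    (hC : ∀ t, 0 ≤ t → ‖errCLM n v (stackedField f (x t))‖ ≤ C) {η : ℝ}
    (hση : b * C ≤ σ * a * η) {t : ℝ} (ht : 0 ≤ t) :
    W (errCLM n v (x t)) ≤ max (W (errCLM n v (x 0))) (b * η ^ 2) := by
  refine forall_le_of_deriv_nonpos_at_max (ι := Unit) (a := 0) (b := t)
    (u := fun _ s => W (errCLM n v (x s)))
    (u' := fun _ s => D (errCLM n v (x s)) (errCLM n v (networkField l f σ (x s))))
    (fun _ s hs => (hx.hasDerivWithinAt_comp_clm (errCLM n v) (hW _) hs.1).mono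
      Icc_subset_Ici_self) (fun _ => le_max_left _ _) ?_ () t (right_mem_Icc.2 ht)
  intro _ s hs _ hge
  have h1 : b * η ^ 2 ≤ b * ‖errCLM n v (x s)‖ ^ 2 :=
    ((le_max_right _ _).trans hge).trans (hWb _)
  have h2 : η ≤ ‖errCLM n v (x s)‖ :=
    le_of_sq_le_sq (le_of_mul_le_mul_left h1 (by linarith)) (norm_nonneg _)
  have h3 := errCLM_orbital_deriv_le (f := f) hv hD hDL hσ (x s)
  have h4 : b * ‖errCLM n v (x s)‖ * ‖errCLM n v (stackedField f (x s))‖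
      ≤ b * ‖errCLM n v (x s)‖ * C :=
    mul_le_mul_of_nonneg_left (hC s hs.1) (mul_nonneg (by linarith) (norm_nonneg _))
  have h5 : σ * a * η ≤ σ * a * ‖errCLM n v (x s)‖ :=
    mul_le_mul_of_nonneg_left h2 (mul_nonneg hσ ha.le)
  have h6 := mul_le_mul_of_nonneg_right (hση.trans h5) (norm_nonneg (errCLM n v (x s)))
  nlinarith

/-- After a short time the synchronization error is small if the coupling is strong. -/
lemma errCLM_lyapunov_le {l : Fin N → Fin N → ℝ} {f : Fin N → Vec n → Vec n}
    {v : Fin N → ℝ} (hv : IsLeftEigenvector l v) {W : Stack N n → ℝ}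
    {D : Stack N n → Stack N n →L[ℝ] ℝ} {a b : ℝ} (ha : 0 < a) (hb : 1 ≤ b)
    (hW : ∀ x, HasFDerivAt W (D x) x) (hD : ∀ x y, |D x y| ≤ b * ‖x‖ * ‖y‖)
    (hWb : ∀ x, W x ≤ b * ‖x‖ ^ 2)
    (hDL : ∀ e : Stack N n, ∑ i, v i • e i = 0 →
      D e (-kronAct (laplacian l) e) ≤ -a * ‖e‖ ^ 2) {σ : ℝ} (hσ : 0 ≤ σ)
    {x : ℝ → Stack N n} (hx : IsSolution (networkField l f σ) x) {C : ℝ}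
    (hC : ∀ t, 0 ≤ t → ‖errCLM n v (stackedField f (x t))‖ ≤ C) {η : ℝ} (hη : 0 < η)
    (hση : 2 * (b * C) ≤ σ * a * η) {τ : ℝ} (hτ : 0 ≤ τ)
    (hτ' : W (errCLM n v (x 0)) ≤ σ * a * η ^ 2 / 2 * τ) {t : ℝ} (ht : τ ≤ t) :
    W (errCLM n v (x t)) ≤ b * η ^ 2 := by
  have hb0 : 0 < b := by linarith
  have hC0 : 0 ≤ C := (norm_nonneg _).trans (hC 0 le_rfl)
  have hbC : 0 ≤ b * C := mul_nonneg hb0.le hC0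
  -- While `W > b η²` the error exceeds `η`. The factor `2` in `hση` then leaves a decay rate of at
  -- least `σ a η² / 2`, which exhausts the initial value of `W` by time `τ`.
  obtain ⟨s, hs, hsW⟩ : ∃ s ∈ Icc 0 τ, W (errCLM n v (x s)) ≤ b * η ^ 2 := by
    by_contra! hcon
    have hanti := antitoneOn_of_hasDerivWithinAt_Ici_nonpos (a := 0) (b := τ)
      (u := fun s => W (errCLM n v (x s)) + σ * a * η ^ 2 / 2 * s)
      (u' := fun s => D (errCLM n v (x s)) (errCLM n v (networkField l f σ (x s)))
        + σ * a * η ^ 2 / 2 * 1)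
      (fun s hs => ((hx.hasDerivWithinAt_comp_clm (errCLM n v) (hW _) hs.1).mono
        Icc_subset_Ici_self).add ((hasDerivWithinAt_id s _).const_mul _)) ?_
    · have h1 := hanti (left_mem_Icc.2 hτ) (right_mem_Icc.2 hτ) hτ
      have h2 := hcon τ (right_mem_Icc.2 hτ)
      have h3 : 0 ≤ b * η ^ 2 := by positivity
      simp only at h1
      linarith
    · intro s hs
      have h2 : η ≤ ‖errCLM n v (x s)‖ :=
        le_of_sq_le_sq (le_of_mul_le_mul_left ((hcon s hs).le.trans (hWb _)) hb0)
          (norm_nonneg _)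
      have h3 := errCLM_orbital_deriv_le (f := f) hv hD hDL hσ (x s)
      have h4 : b * ‖errCLM n v (x s)‖ * ‖errCLM n v (stackedField f (x s))‖
          ≤ b * ‖errCLM n v (x s)‖ * C :=
        mul_le_mul_of_nonneg_left (hC s hs.1) (mul_nonneg hb0.le (norm_nonneg _))
      have hσa : 0 ≤ σ * a := mul_nonneg hσ ha.le
      have h5 := mul_le_mul_of_nonneg_left h2 hσa
      have h6 := mul_le_mul_of_nonneg_right (hση.trans h5) (norm_nonneg (errCLM n v (x s)))
      have h7 := mul_le_mul_of_nonneg_left (pow_le_pow_left₀ hη.le h2 2) hσa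
      nlinarith
  have h := errCLM_lyapunov_le_max hv ha hb hW hD hWb hDL hσ (hx.shift hs.1)
    (fun r hr => hC _ (add_nonneg hs.1 hr)) (η := η) (by linarith)
    (t := t - s) (sub_nonneg.2 (hs.2.trans ht))
  simpa [hsW] using h

/-- The mean-field state follows the reduced dynamics as long as the error is small. -/
lemma norm_meanCLM_sub_le {l : Fin N → Fin N → ℝ} {f : Fin N → Vec n → Vec n}
    {v : Fin N → ℝ} (hv0 : ∀ i, 0 ≤ v i) (hv : IsLeftEigenvector l v) {R : ℝ} {K : NNReal}
    (hK1 : 1 ≤ K) (hK : LipschitzOnWith K (reducedField f v) (Metric.closedBall 0 R)) {C : ℝ}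
    (hC0 : 0 ≤ C)
    (hC : ∀ x : Stack N n, maxNorm x ≤ R →
      ‖meanCLM n v (stackedField f x) - reducedField f v (meanCLM n v x)‖
        ≤ C * ‖errCLM n v x‖) {σ : ℝ}
    {x : ℝ → Stack N n} (hx : IsSolution (networkField l f σ) x)
    (hxR : ∀ t, 0 ≤ t → maxNorm (x t) ≤ R) {η : ℝ} (hη : 0 ≤ η)
    (hxη : ∀ t, 0 ≤ t → ‖errCLM n v (x t)‖ ≤ η)
    {z : ℝ → Vec n} (hz : IsSolution (reducedField f v) z)
    (hzR : ∀ t, 0 ≤ t → ‖z t‖ ≤ R) {δ : ℝ} (hδ : ‖meanCLM n v (x 0) - z 0‖ ≤ δ)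
    {t : ℝ} (ht : 0 ≤ t) :
    ‖meanCLM n v (x t) - z t‖ ≤ (δ + C * η) * Real.exp (K * t) := by
  have hm : ∀ s, 0 ≤ s → HasDerivWithinAt (fun s => meanCLM n v (x s))
      (meanCLM n v (stackedField f (x s))) (Ici 0) s := fun s hs => by
    have := hx.hasDerivWithinAt_clm (meanCLM n v) hs
    rwa [meanCLM_networkField hv] at this
  have h := dist_le_of_approx_trajectories_ODE_of_mem (v := fun _ => reducedField f v)
    (s := fun _ => Metric.closedBall 0 R) (K := K) (a := 0) (b := t) (εf := C * η) (εg := 0)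
    (f := fun s => meanCLM n v (x s)) (f' := fun s => meanCLM n v (stackedField f (x s)))
    (g := z) (g' := fun s => reducedField f v (z s)) (δ := δ) (fun _ _ => hK)
    (fun s hs => (hm s hs.1).continuousWithinAt.mono Icc_subset_Ici_self)
    (fun s hs => (hm s hs.1).mono (Ici_subset_Ici.2 hs.1))
    (fun s hs => by
      rw [dist_eq_norm]
      exact (hC _ (hxR s hs.1)).trans (mul_le_mul_of_nonneg_left (hxη s hs.1) hC0))
    (fun s hs => mem_closedBall_zero_iff.2
      ((norm_meanCLM_le_maxNorm hv0 hv.sum_eq_one _).trans (hxR s hs.1)))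
    (hz.continuousOn.mono Icc_subset_Ici_self) (fun s hs => hz.hasDerivWithinAt_Ici hs.1)
    (fun s _ => (dist_self _).le)
    (fun s hs => mem_closedBall_zero_iff.2 (hzR s hs.1)) (by rwa [dist_eq_norm]) t
    (right_mem_Icc.2 ht)
  rw [dist_eq_norm, add_zero, sub_zero] at h
  exact h.trans (gronwallBound_le (by exact_mod_cast hK1) (mul_nonneg hC0 hη))

/-- Practical convergence to the origin, and practical tracking of the reduced dynamics, on a
bounded set of states. -/
lemma exists_practical_bounds {l : Fin N → Fin N → ℝ} {f : Fin N → Vec n → Vec n}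
    {v : Fin N → ℝ} (hl : ∀ i j, 0 ≤ l i j) (hgraph : ConnectedDigraph l)
    (hf1 : ∀ i, ContDiff ℝ 1 (f i)) (hv : IsLeftEigenvector l v)
    (hred : GloballyAsymptoticallyStable (reducedField f v))
    {ρ : ℝ} (hρ : 0 < ρ) (hf : ∀ i x, ρ ≤ ‖x‖ → inner ℝ x (f i x) ≤ 0) {R : ℝ} (hR : ρ ≤ R) :
    ∃ c : ℝ, 0 ≤ c ∧ ∀ β : ℝ, 0 < β → ∃ σ₀ T : ℝ, 0 < σ₀ ∧ 0 ≤ T ∧ ∀ σ, σ₀ ≤ σ →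
      ∀ x : ℝ → Stack N n, IsSolution (networkField l f σ) x →
        (∀ t, 0 ≤ t → maxNorm (x t) ≤ R) →
        (∀ t, T ≤ t → ‖x t‖ ≤ β) ∧
        ∃ z : ℝ → Vec n, IsSolution (reducedField f v) z ∧ z 0 = meanCLM n v (x 0) ∧
          ∀ t, 0 ≤ t → ∃ s, 0 ≤ s ∧ ‖x t‖ ≤ N * ‖z s‖ + c * ‖x 0‖ + β := by
  have hv0 : ∀ i, 0 ≤ v i := fun i => hv.nonneg hl hgraph i
  have hN : (0 : ℝ) < N := by exact_mod_cast hgraph.choose.pos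
  have hinv := norm_le_of_isSolution_reducedField hv0 hρ hf
  obtain ⟨W, D, a, b, ha, hb, hW, hD, hWb, hWe⟩ := exists_consensus_lyapunov n hl hgraph hv
  have hb0 : 0 < b := by linarith
  obtain ⟨C₁, hC₁0, hC₁⟩ := exists_bound_of_maxNorm_le
    ((errCLM n v).continuous.comp (contDiff_stackedField hf1).continuous) R
  obtain ⟨C₂, hC₂0, hC₂⟩ := exists_bound_of_maxNorm_le (errCLM n v).continuous R
  obtain ⟨C₃, hC₃0, hC₃⟩ := exists_bound_of_maxNorm_le
    ((meanCLM n v).continuous.comp (contDiff_stackedField hf1).continuous) R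
  obtain ⟨C, hC0, hC⟩ := exists_lipschitz_mean hf1 hv0 hv.sum_eq_one R
  obtain ⟨K₀, hK₀⟩ := (contDiff_reducedField hf1 v).contDiffOn.exists_lipschitzOnWith one_ne_zero
    (convex_closedBall (0 : Vec n) R) (isCompact_closedBall _ _)
  set K : NNReal := K₀ + 1
  have hK1 : 1 ≤ K := le_add_self
  have hK : LipschitzOnWith K (reducedField f v) (Metric.closedBall 0 R) :=
    hK₀.weaken le_self_add
  -- From `‖e(t)‖ ≤ b ‖e(0)‖ + η` and `‖e(0)‖ ≤ (1 + N) ‖x(0)‖`; this constant must not depend on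
  -- `β`.
  refine ⟨b * (1 + N), by positivity, fun β hβ => ?_⟩
  -- Half of `β` is for the mean field, which enters with the factor `N`, and half for the error. Of
  -- `γ`, one half bounds the reduced solution after the horizon `T`, the other the tracking error.
  set γ : ℝ := β / (2 * N) with hγ
  have hγ0 : 0 < γ := by positivity
  have hNγ : N * γ = β / 2 := by rw [hγ]; field_simp
  obtain ⟨T, hT0, hT⟩ := hred.exists_uniform_time (contDiff_reducedField hf1 v) hinv hR
    (half_pos hγ0)
  set M : ℝ := Real.exp (K * T) with hM
  have hM1 : 1 ≤ M := Real.one_le_exp (mul_nonneg K.2 hT0)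
  have hM0 : 0 < M := Real.exp_pos _
  -- Over the horizon, Grönwall amplifies by at most `M` both the forcing `C η` due to the error and
  -- the drift `C₃ τ` of the mean field during the initial layer `[0, τ]`; each is allotted `γ / 4`.
  obtain ⟨η, hη0, hηβ, hηγ⟩ : ∃ η : ℝ, 0 < η ∧ η ≤ β / 2 ∧ C * η * M ≤ γ / 4 := by
    refine ⟨min (β / 2) (γ / 4 / ((C + 1) * M)), by positivity, min_le_left _ _, ?_⟩
    have h1 := mul_le_mul_of_nonneg_left (min_le_right (β / 2) (γ / 4 / ((C + 1) * M)))
      (show 0 ≤ (C + 1) * M by positivity)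
    rw [mul_div_cancel₀ _ (by positivity)] at h1
    have h2 : 0 ≤ M * min (β / 2) (γ / 4 / ((C + 1) * M)) := by positivity
    nlinarith
  obtain ⟨τ, hτ0, hτγ⟩ : ∃ τ : ℝ, 0 < τ ∧ C₃ * τ * M ≤ γ / 4 := by
    refine ⟨γ / 4 / ((C₃ + 1) * M), by positivity, ?_⟩
    have h1 : (C₃ + 1) * M * (γ / 4 / ((C₃ + 1) * M)) = γ / 4 :=
      mul_div_cancel₀ _ (by positivity)
    have h2 : 0 ≤ M * (γ / 4 / ((C₃ + 1) * M)) := by positivity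
    nlinarith
  have hτγ' : C₃ * τ ≤ γ / 4 :=
    (le_mul_of_one_le_right (by positivity) hM1).trans hτγ
  set η' : ℝ := η / b with hη'
  have hη'0 : 0 < η' := by positivity
  have hbη' : b * η' ^ 2 ≤ η ^ 2 := by
    have h1 : b * η' ^ 2 = η ^ 2 / b := by rw [hη']; field_simp
    rw [h1]
    exact div_le_self (by positivity) hb
  -- The second summand lets the coupling dominate the error part of `F` at size `η'`; the third
  -- dissipates the initial value of `W`, at most `b C₂²`, within time `τ`.
  set σ₀ : ℝ := 1 + 2 * (b * C₁) / (a * η') + b * C₂ ^ 2 / (a * η' ^ 2 / 2 * τ) with hσ₀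
  have hσ₀1 : 0 < σ₀ := by positivity
  refine ⟨σ₀, τ + T, hσ₀1, by positivity, fun σ hσ x hx hxR => ?_⟩
  have hσ0 : 0 ≤ σ := hσ₀1.le.trans hσ
  have hση : 2 * (b * C₁) ≤ σ * a * η' := by
    have h1 : 2 * (b * C₁) / (a * η') ≤ σ := by
      have : 0 ≤ b * C₂ ^ 2 / (a * η' ^ 2 / 2 * τ) := by positivity
      linarith
    rw [div_le_iff₀ (by positivity)] at h1
    linarith
  have hWτ : W (errCLM n v (x 0)) ≤ σ * a * η' ^ 2 / 2 * τ := by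
    have h1 : b * C₂ ^ 2 / (a * η' ^ 2 / 2 * τ) ≤ σ := by
      have : 0 ≤ 2 * (b * C₁) / (a * η') := by positivity
      linarith
    rw [div_le_iff₀ (by positivity)] at h1
    have h2 : ‖errCLM n v (x 0)‖ ^ 2 ≤ C₂ ^ 2 :=
      pow_le_pow_left₀ (norm_nonneg _) (hC₂ _ (hxR 0 le_rfl)) 2
    have h3 := mul_le_mul_of_nonneg_left h2 hb0.le
    linarith [(hWb (errCLM n v (x 0))).2]
  have hsum : ∀ y : Stack N n, ∑ i, v i • errCLM n v y i = 0 := sum_smul_errCLM hv.sum_eq_one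
  have hC₁x : ∀ t, 0 ≤ t → ‖errCLM n v (stackedField f (x t))‖ ≤ C₁ := fun t ht =>
    hC₁ _ (hxR t ht)
  have hlate : ∀ t, τ ≤ t → ‖errCLM n v (x t)‖ ≤ η := by
    intro t ht
    have h1 := errCLM_lyapunov_le hv ha hb hW hD (fun y => (hWb y).2) (fun e he => (hWe e he).2)
      hσ0 hx hC₁x hη'0 hση hτ0.le hWτ ht
    exact le_of_sq_le_sq (((hWe _ (hsum (x t))).1.trans h1).trans hbη') hη0.le
  have hall : ∀ t, 0 ≤ t → ‖errCLM n v (x t)‖ ≤ b * ‖errCLM n v (x 0)‖ + η := by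
    intro t ht
    have h1 := errCLM_lyapunov_le_max hv ha hb hW hD (fun y => (hWb y).2)
      (fun e he => (hWe e he).2) hσ0 hx hC₁x (η := η')
      (by linarith [mul_nonneg hb0.le hC₁0]) ht
    have h2 : 0 ≤ b * ‖errCLM n v (x 0)‖ := by positivity
    refine le_of_sq_le_sq (((hWe _ (hsum (x t))).1.trans h1).trans (max_le ?_ ?_)) (by positivity)
    · refine (hWb _).2.trans ?_
      have h3 : b * ‖errCLM n v (x 0)‖ ^ 2 ≤ (b * ‖errCLM n v (x 0)‖) ^ 2 := by
        rw [mul_pow]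
        exact mul_le_mul_of_nonneg_right (by nlinarith) (by positivity)
      exact h3.trans (pow_le_pow_left₀ h2 (by linarith) 2)
    · exact hbη'.trans (pow_le_pow_left₀ hη0.le (by linarith) 2)
  have hmR : ∀ t, 0 ≤ t → ‖meanCLM n v (x t)‖ ≤ R := fun t ht =>
    (norm_meanCLM_le_maxNorm hv0 hv.sum_eq_one _).trans (hxR t ht)
  have hslow : ∀ t, 0 ≤ t → ‖meanCLM n v (x t) - meanCLM n v (x 0)‖ ≤ C₃ * t := by
    intro t ht
    have := norm_image_sub_le_of_norm_deriv_le_segment' (a := 0) (b := t) (C := C₃)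
      (f := fun s => meanCLM n v (x s))
      (fun s hs => (hx.hasDerivWithinAt_clm (meanCLM n v) hs.1).mono Icc_subset_Ici_self)
      (fun s hs => by
        rw [meanCLM_networkField hv]
        exact hC₃ _ (hxR s hs.1)) t (right_mem_Icc.2 ht)
    simpa using this
  have hclose : ∀ r, τ ≤ r → ∀ z, IsSolution (reducedField f v) z → ‖z 0‖ ≤ R → ∀ δ,
      ‖meanCLM n v (x r) - z 0‖ ≤ δ → δ * M ≤ γ / 4 → ∀ s, 0 ≤ s → s ≤ T →
      ‖meanCLM n v (x (r + s))‖ ≤ ‖z s‖ + γ / 2 := by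
    intro r hr z hz hzR δ hδ hδM s hs hsT
    have hr0 : 0 ≤ r := hτ0.le.trans hr
    have hδ0 : 0 ≤ δ := (norm_nonneg _).trans hδ
    have h1 := norm_meanCLM_sub_le hv0 hv hK1 hK hC0 hC (hx.shift hr0)
      (fun t ht => hxR _ (add_nonneg hr0 ht)) hη0.le
      (fun t ht => hlate _ (hr.trans (le_add_of_nonneg_right ht))) hz
      (hinv R hR z hz hzR) (δ := δ) (by simpa using hδ) hs
    have h2 : Real.exp (K * s) ≤ M :=
      Real.exp_le_exp.2 (mul_le_mul_of_nonneg_left hsT K.2)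
    have h3 := mul_le_mul_of_nonneg_left h2 (show 0 ≤ δ + C * η by positivity)
    have h4 := norm_le_norm_add_norm_sub' (meanCLM n v (x (r + s))) (z s)
    nlinarith
  -- The reduced solution is restarted from the mean field at time `t - T`, so the comparison never
  -- lasts longer than `T` and `M` does not grow with `t`.
  have hfinal : ∀ t, τ + T ≤ t → ‖meanCLM n v (x t)‖ ≤ γ := by
    intro t ht
    have htT : τ ≤ t - T := by linarith
    obtain ⟨z, hz, hz0⟩ := hred.complete (meanCLM n v (x (t - T)))
    have hzR : ‖z 0‖ ≤ R := by rw [hz0]; exact hmR _ (hτ0.le.trans htT)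
    have h1 := hclose (t - T) htT z hz hzR 0 (by simp [hz0]) (by simp; positivity) T hT0 le_rfl
    rw [sub_add_cancel] at h1
    linarith [hT z hz hzR T le_rfl]
  refine ⟨fun t ht => ?_, ?_⟩
  · have h1 := norm_le_mean_add_err v (x t)
    have h2 := hlate t (by linarith)
    have h3 := mul_le_mul_of_nonneg_left (hfinal t ht) hN.le
    linarith
  · obtain ⟨z, hz, hz0⟩ := hred.complete (meanCLM n v (x 0))
    refine ⟨z, hz, hz0, fun t ht => ?_⟩
    -- In the layer `[0, τ]` the mean field hardly moves, on `[τ, τ + T]` it tracks `z` with delay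
    -- `τ`, and later it is already below `γ`.
    obtain ⟨s, hs, hsm⟩ : ∃ s, 0 ≤ s ∧ ‖meanCLM n v (x t)‖ ≤ ‖z s‖ + γ := by
      rcases le_total t τ with h | h
      · refine ⟨0, le_rfl, ?_⟩
        have h1 := hslow t ht
        have h2 := mul_le_mul_of_nonneg_left h hC₃0
        have h3 := norm_le_norm_add_norm_sub' (meanCLM n v (x t)) (meanCLM n v (x 0))
        rw [hz0]
        linarith
      · rcases le_total t (τ + T) with h' | h'
        · refine ⟨t - τ, sub_nonneg.2 h, ?_⟩
          have h1 := hclose τ le_rfl z hz (by rw [hz0]; exact hmR 0 le_rfl) (C₃ * τ)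
            (by rw [hz0]; exact hslow τ hτ0.le) hτγ (t - τ) (sub_nonneg.2 h) (by linarith)
          rw [add_sub_cancel] at h1
          linarith
        · exact ⟨0, le_rfl, (hfinal t h').trans (le_add_of_nonneg_left (norm_nonneg _))⟩
    refine ⟨s, hs, ?_⟩
    have h1 := norm_le_mean_add_err v (x t)
    have h2 := hall t ht
    have h3 := mul_le_mul_of_nonneg_left hsm hN.le
    have h4 := mul_le_mul_of_nonneg_left (norm_errCLM_le hv0 hv.sum_eq_one (x 0)) hb0.le
    rw [← mul_assoc] at h4
    linarith

end StrongCoupling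

/-! ### Local Lyapunov function of the strongly coupled network -/

lemma continuous_of_hasFDerivAt {E : Type*} [NormedAddCommGroup E] [NormedSpace ℝ E] {W : E → ℝ}
    {D : E → E →L[ℝ] ℝ} (hW : ∀ x, HasFDerivAt W (D x) x) : Continuous W :=
  continuous_iff_continuousAt.2 fun x => (hW x).continuousAt

section MainResults

variable {N n : ℕ}

/-- The synchronization part of `F` in terms of the mean-field state and the error. -/
lemma errCLM_stackedField_eq {l : Fin N → Fin N → ℝ} {v : Fin N → ℝ}
    {V : Matrix (Fin N) (Fin (N - 1)) ℝ} {Vd : Matrix (Fin (N - 1)) (Fin N) ℝ}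
    (hdec : IsBlockDecomposition l v V Vd) (f : Fin N → Vec n → Vec n) (x : Stack N n) :
    errCLM n v (stackedField f x)
      = kronAct V (syncField f V Vd (meanCLM n v x) (kronAct Vd x)) := by
  have h : ∀ y : Stack N n, kronAct V (kronAct Vd y) = errCLM n v y := fun y => by
    rw [← kronAct_mul, hdec.self_mul]; rfl
  rw [syncField, h, h, errCLM_add_diagStack]

/-- The growth of the synchronization part of `F` near the origin. -/
lemma exists_growth_errCLM {l : Fin N → Fin N → ℝ} {f : Fin N → Vec n → Vec n}
    {v : Fin N → ℝ} (hf1 : ∀ i, ContDiff ℝ 1 (f i)) (hf0 : ∀ i, f i 0 = 0)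
    (hv0 : ∀ i, 0 ≤ v i) (hv : ∑ i, v i = 1)
    {V : Matrix (Fin N) (Fin (N - 1)) ℝ} {Vd : Matrix (Fin (N - 1)) (Fin N) ℝ} {r : ℝ}
    {Vm : Vec n → ℝ} {α : ℝ → ℝ} {c : ℝ} (hdec : IsBlockDecomposition l v V Vd) (hr : 0 < r)
    (hDG : DecayAndGrowth f v V Vd r Vm α c) :
    ∃ β C : ℝ, 0 < β ∧ β ≤ r ∧ 0 ≤ C ∧ ∀ x : Stack N n, ‖x‖ ≤ β →
      ‖errCLM n v (stackedField f x)‖ ≤ C * (α ‖meanCLM n v x‖ + ‖errCLM n v x‖) ∧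
      ‖fderiv ℝ Vm (meanCLM n v x)‖ ≤ c * α ‖meanCLM n v x‖ := by
  set P := ‖kronCLM n Vd‖ with hP
  set Q := ‖kronCLM n V‖ with hQ
  have hP0 : 0 ≤ P := norm_nonneg (kronCLM n Vd)
  have hQ0 : 0 ≤ Q := norm_nonneg (kronCLM n V)
  -- For `‖x‖ ≤ β` one has `‖x_m‖ ≤ β` and `‖e_v‖ ≤ P β`, and `β² + P² β² ≤ (β (1 + P))² = r²`.
  set β : ℝ := r / (1 + P) with hβ
  have hβ0 : 0 < β := by positivity
  have hβr : β * (1 + P) = r := div_mul_cancel₀ _ (by positivity)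
  obtain ⟨K, hK⟩ := (contDiff_stackedField hf1).contDiffOn.exists_lipschitzOnWith one_ne_zero
    (convex_closedBall (0 : Stack N n) ((1 + N) * β)) (isCompact_closedBall _ _)
  have hc := hDG.c_pos
  refine ⟨β, Q * (c + P * K), hβ0, by nlinarith, by positivity, fun x hx => ?_⟩
  have hm : ‖meanCLM n v x‖ ≤ β :=
    (norm_meanCLM_le_maxNorm hv0 hv x).trans ((maxNorm_le_norm x).trans hx)
  have hev : ‖kronAct Vd x‖ ≤ P * β :=
    ((kronCLM n Vd).le_opNorm x).trans (mul_le_mul_of_nonneg_left hx hP0)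
  have hmem : ‖meanCLM n v x‖ ^ 2 + ‖kronAct Vd x‖ ^ 2 ≤ r ^ 2 := by
    have h1 := pow_le_pow_left₀ (norm_nonneg _) hm 2
    have h2 := pow_le_pow_left₀ (norm_nonneg _) hev 2
    rw [← hβr]
    nlinarith [mul_nonneg hP0 (sq_nonneg β)]
  have hg := hDG.growth _ _ hmem
  refine ⟨?_, (le_max_right _ _).trans hg⟩
  have hα : 0 ≤ α ‖meanCLM n v x‖ := by
    have := (norm_nonneg _).trans ((le_max_right _ _).trans hg)
    exact nonneg_of_mul_nonneg_right this hc
  -- At `x_m = 0` the field depends on the error alone and vanishes with it, so it is bounded by a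
  -- multiple of `‖e‖`. The growth condition bounds the remaining difference by `α ‖x_m‖`.
  have h0 : ‖syncField f V Vd 0 (kronAct Vd x)‖ ≤ P * (K * ‖errCLM n v x‖) := by
    have he : kronAct V (kronAct Vd x) + diagStack 0 = errCLM n v x := by
      rw [← kronAct_mul, hdec.self_mul]
      ext i : 1
      simp [diagStack, errCLM]
    rw [syncField, he]
    refine ((kronCLM n Vd).le_opNorm _).trans (mul_le_mul_of_nonneg_left ?_ hP0)
    have hF0 : stackedField f (0 : Stack N n) = 0 := by
      ext i : 1
      simp [stackedField, hf0]
    have h1 := hK.dist_le_mul (errCLM n v x) (mem_closedBall_zero_iff.2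
      ((norm_errCLM_le hv0 hv x).trans (mul_le_mul_of_nonneg_left hx (by positivity)))) 0
      (Metric.mem_closedBall_self (by positivity))
    rwa [hF0, dist_zero_right, dist_zero_right] at h1
  rw [errCLM_stackedField_eq hdec]
  refine ((kronCLM n V).le_opNorm _).trans ?_
  rw [← hQ, mul_assoc]
  refine mul_le_mul_of_nonneg_left ?_ hQ0
  have h1 := norm_le_norm_add_norm_sub' (syncField f V Vd (meanCLM n v x) (kronAct Vd x))
    (syncField f V Vd 0 (kronAct Vd x))
  have h2 := (le_max_left _ _).trans hg
  have h3 : 0 ≤ c * ‖errCLM n v x‖ := by positivity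
  have h4 : 0 ≤ P * K * α ‖meanCLM n v x‖ := by positivity
  nlinarith

/-- The orbital derivative of `V_m(x_m) + W(e)` near the origin for strong coupling. -/
lemma orbital_deriv_le_of_growth {l : Fin N → Fin N → ℝ} {f : Fin N → Vec n → Vec n}
    {v : Fin N → ℝ} (hv : IsLeftEigenvector l v) {D : Stack N n → Stack N n →L[ℝ] ℝ}
    {a b : ℝ} (hb : 0 ≤ b) (hD : ∀ x y, |D x y| ≤ b * ‖x‖ * ‖y‖)
    (hDL : ∀ e : Stack N n, ∑ i, v i • e i = 0 →
      D e (-kronAct (laplacian l) e) ≤ -a * ‖e‖ ^ 2) {σ : ℝ} (hσ : 0 ≤ σ)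
    {Vm : Vec n → ℝ} {A c C C₄ : ℝ} {x : Stack N n}
    (hF : ‖errCLM n v (stackedField f x)‖ ≤ C₄ * (A + ‖errCLM n v x‖))
    (hV : ‖fderiv ℝ Vm (meanCLM n v x)‖ ≤ c * A)
    (hC : ‖meanCLM n v (stackedField f x) - reducedField f v (meanCLM n v x)‖
      ≤ C * ‖errCLM n v x‖)
    (hdecay : fderiv ℝ Vm (meanCLM n v x) (reducedField f v (meanCLM n v x)) ≤ -A ^ 2)
    (hσa : b * C₄ + (c * C + b * C₄) ^ 2 / 2 + 1 ≤ σ * a) :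
    fderiv ℝ Vm (meanCLM n v x) (meanCLM n v (networkField l f σ x))
      + D (errCLM n v x) (errCLM n v (networkField l f σ x))
      ≤ -(A ^ 2 / 2 + ‖errCLM n v x‖ ^ 2) := by
  have he0 : 0 ≤ ‖errCLM n v x‖ := norm_nonneg _
  have h2 := errCLM_orbital_deriv_le (f := f) hv hD hDL hσ x
  have h1 : fderiv ℝ Vm (meanCLM n v x) (meanCLM n v (networkField l f σ x))
      ≤ -A ^ 2 + c * A * (C * ‖errCLM n v x‖) := by
    rw [meanCLM_networkField hv]
    have h3 := (le_abs_self _).trans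
      ((fderiv ℝ Vm (meanCLM n v x)).le_of_opNorm_le_of_le hV hC)
    rw [map_sub] at h3
    linarith
  have h3 := mul_le_mul_of_nonneg_left hF (mul_nonneg hb he0)
  generalize ‖errCLM n v x‖ = e at *
  have h4 := mul_le_mul_of_nonneg_right hσa (sq_nonneg e)
  -- With `k = c C + b C₄`, the cross term `k A e` is at most `A² / 2 + k² e² / 2`; the summand `1`
  -- in `hσa` leaves `-e²`.
  nlinarith [sq_nonneg (A - (c * C + b * C₄) * e)]

/-- Near the origin, the network has a strict Lyapunov function for strong coupling. -/
lemma exists_network_lyapunov {l : Fin N → Fin N → ℝ} {f : Fin N → Vec n → Vec n}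
    {v : Fin N → ℝ} (hl : ∀ i j, 0 ≤ l i j) (hgraph : ConnectedDigraph l)
    (hf1 : ∀ i, ContDiff ℝ 1 (f i)) (hf0 : ∀ i, f i 0 = 0) (hv : IsLeftEigenvector l v)
    {V : Matrix (Fin N) (Fin (N - 1)) ℝ} {Vd : Matrix (Fin (N - 1)) (Fin N) ℝ} {r : ℝ}
    {Vm : Vec n → ℝ} {α : ℝ → ℝ} {c : ℝ} (hdec : IsBlockDecomposition l v V Vd) (hr : 0 < r)
    (hDG : DecayAndGrowth f v V Vd r Vm α c) :
    ∃ (U q : Stack N n → ℝ) (β σ₀ : ℝ), 0 < β ∧ 0 < σ₀ ∧ Continuous U ∧ U 0 = 0 ∧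
      (∀ x, x ≠ 0 → 0 < U x) ∧ Continuous q ∧ (∀ x, 0 ≤ q x) ∧ (∀ x, x ≠ 0 → 0 < q x) ∧
      ∀ σ, σ₀ ≤ σ → ∃ U' : Stack N n → ℝ,
        (∀ x : ℝ → Stack N n, IsSolution (networkField l f σ) x → ∀ t, 0 ≤ t →
          HasDerivWithinAt (fun s => U (x s)) (U' (x t)) (Ici 0) t) ∧
        ∀ x, ‖x‖ ≤ β → U' x ≤ -q x := by
  have hv0 : ∀ i, 0 ≤ v i := fun i => hv.nonneg hl hgraph i
  obtain ⟨W, D, a, b, ha, hb, hW, hD, hWb, hWe⟩ := exists_consensus_lyapunov n hl hgraph hv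
  obtain ⟨β, C₄, hβ0, hβr, hC₄0, hC₄⟩ := exists_growth_errCLM hf1 hf0 hv0 hv.sum_eq_one hdec hr hDG
  obtain ⟨C, hC0, hC⟩ := exists_lipschitz_mean hf1 hv0 hv.sum_eq_one β
  have hc := hDG.c_pos
  have hsum : ∀ y : Stack N n, ∑ i, v i • errCLM n v y i = 0 := sum_smul_errCLM hv.sum_eq_one
  have hWcont : Continuous W := continuous_of_hasFDerivAt hW
  have hVm0 : ∀ y, 0 ≤ Vm y := fun y => by
    rcases eq_or_ne y 0 with rfl | h
    · exact hDG.map_zero.ge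
    · exact (hDG.pos y h).le
  have hαpos : ∀ y : Vec n, y ≠ 0 → 0 < α ‖y‖ := fun y hy => by
    have := hDG.classKInfty.strictMono (self_mem_Ici (a := (0 : ℝ)))
      (show ‖y‖ ∈ Ici (0 : ℝ) from norm_nonneg y) (norm_pos_iff.2 hy)
    rwa [hDG.classKInfty.map_zero] at this
  have hmean : ∀ x : Stack N n, x ≠ 0 → errCLM n v x = 0 → meanCLM n v x ≠ 0 := by
    intro x hx he hm
    refine hx (norm_le_zero_iff.1 ?_)
    simpa [he, hm] using norm_le_mean_add_err v x
  -- Only the orbital derivative depends on `σ`. The function, its decay rate `q` and the radius `β`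
  -- do not, so that `β` can be fixed before attractivity dictates how large `σ` must be.
  refine ⟨fun x => Vm (meanCLM n v x) + W (errCLM n v x),
    fun x => α ‖meanCLM n v x‖ ^ 2 / 2 + ‖errCLM n v x‖ ^ 2, β,
    (b * C₄ + (c * C + b * C₄) ^ 2 / 2 + 1) / a, hβ0, by positivity, ?_, ?_, ?_, ?_, fun x => by positivity, ?_,
    fun σ hσ => ⟨fun x => fderiv ℝ Vm (meanCLM n v x) (meanCLM n v (networkField l f σ x))
      + D (errCLM n v x) (errCLM n v (networkField l f σ x)), ?_, ?_⟩⟩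
  · exact (hDG.contDiff.continuous.comp (meanCLM n v).continuous).add
      (hWcont.comp (errCLM n v).continuous)
  · have h1 : W 0 = 0 := le_antisymm (by simpa using (hWb 0).2) (hWb 0).1
    simp [hDG.map_zero, h1]
  · intro x hx
    by_cases he : errCLM n v x = 0
    · exact add_pos_of_pos_of_nonneg (hDG.pos _ (hmean x hx he)) (hWb _).1
    · have h1 : 0 < ‖errCLM n v x‖ ^ 2 := by
        have := norm_pos_iff.2 he
        positivity
      exact add_pos_of_nonneg_of_pos (hVm0 _) (h1.trans_le (hWe _ (hsum x)).1)
  · have h1 : Continuous fun x : Stack N n => α ‖meanCLM n v x‖ :=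
      hDG.classKInfty.cont.comp_continuous (meanCLM n v).continuous.norm
        (fun x => norm_nonneg _)
    exact ((h1.pow 2).div_const 2).add ((errCLM n v).continuous.norm.pow 2)
  · intro x hx
    by_cases he : errCLM n v x = 0
    · have := hαpos _ (hmean x hx he)
      positivity
    · have := norm_pos_iff.2 he
      positivity
  · intro x hx t ht
    exact (hx.hasDerivWithinAt_comp_clm (meanCLM n v)
      (hDG.contDiff.differentiable one_ne_zero _).hasFDerivAt ht).add
      (hx.hasDerivWithinAt_comp_clm (errCLM n v) (hW _) ht)
  · intro x hx
    have hσa : b * C₄ + (c * C + b * C₄) ^ 2 / 2 + 1 ≤ σ * a := (div_le_iff₀ ha).1 hσ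
    have hσ0 : 0 ≤ σ := le_trans (by positivity) hσ
    obtain ⟨hF, hV⟩ := hC₄ x hx
    have hxβ : maxNorm x ≤ β := (maxNorm_le_norm x).trans hx
    have hmβ : ‖meanCLM n v x‖ ≤ r :=
      ((norm_meanCLM_le_maxNorm hv0 hv.sum_eq_one x).trans hxβ).trans hβr
    exact orbital_deriv_le_of_growth hv (by linarith) hD (fun e he => (hWe e he).2) hσ0
      hF hV (hC x hxβ)
      (hDG.decay _ hmβ) hσa

end MainResults

end DynNet

/-! ### Assembly of practical stability and asymptotic stability -/

open DynNet in
theorem theorem1 {N n : ℕ} (l : Fin N → Fin N → ℝ) (f : Fin N → DynNet.Vec n → DynNet.Vec n)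
    (v : Fin N → ℝ)
    (hl : ∀ i j, 0 ≤ l i j)
    (hgraph : DynNet.ConnectedDigraph l)
    (hf : ∀ i, ContDiff ℝ 1 (f i))
    (hf0 : ∀ i, f i 0 = 0)
    (hpass : ∀ i, DynNet.StrictlySemiPassive (f i))
    (hv : DynNet.IsLeftEigenvector l v)
    (hred : DynNet.GloballyAsymptoticallyStable (DynNet.reducedField f v)) :
    DynNet.GloballyAsymptoticallyPracticallyStable
        (fun ε : ℝ => DynNet.networkField l f (1 / ε)) ∧
    ∀ (V : Matrix (Fin N) (Fin (N - 1)) ℝ) (Vd : Matrix (Fin (N - 1)) (Fin N) ℝ)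
      (r : ℝ) (Vm : DynNet.Vec n → ℝ) (α : ℝ → ℝ) (c : ℝ),
      DynNet.IsBlockDecomposition l v V Vd → 0 < r →
      DynNet.DecayAndGrowth f v V Vd r Vm α c →
      ∃ σs : ℝ, 0 < σs ∧ ∀ σ : ℝ, σs ≤ σ →
        DynNet.GloballyAsymptoticallyStable (DynNet.networkField l f σ) := by
  have hN : (0 : ℝ) < N := by exact_mod_cast hgraph.choose.pos
  have hv0 : ∀ i, 0 ≤ v i := fun i => hv.nonneg hl hgraph i
  obtain ⟨ρ, hρ, hin⟩ := exists_common_inner_nonpos hpass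
  have hcomplete : ∀ σ, 0 < σ → ForwardComplete (networkField l f σ) := fun σ hσ =>
    forwardComplete_networkField hl hf hρ hin hσ.le
  -- Any radius strictly above `ρ` would do: absorption is available only for such radii.
  obtain ⟨c₀, hc₀, hbounds⟩ := exists_practical_bounds hl hgraph hf hv hred hρ hin
    (R := ρ + 1) (by linarith)
  have hattr : ∀ β : ℝ, 0 < β → ∃ σ₀ : ℝ, 0 < σ₀ ∧ ∀ σ, σ₀ ≤ σ →
      ∀ x : ℝ → Stack N n, IsSolution (networkField l f σ) x →
        ∃ T : ℝ, 0 < T ∧ ∀ t : ℝ, T ≤ t → ‖x t‖ ≤ β := by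
    intro β hβ
    obtain ⟨σ₀, T, hσ₀, hT, h⟩ := hbounds β hβ
    refine ⟨σ₀, hσ₀, fun σ hσ x hx => ?_⟩
    obtain ⟨T₀, hT₀, hK⟩ := exists_maxNorm_le hl hgraph hf hv hred hρ hin (hσ₀.trans_le hσ) hx
      (lt_add_one ρ)
    refine ⟨T₀ + T + 1, by positivity, fun t ht => ?_⟩
    have := (h σ hσ _ (hx.shift hT₀) fun s hs => hK _ (le_add_of_nonneg_right hs)).1 (t - T₀)
      (by linarith)
    simpa using this
  have hinvε : ∀ {σ₀ ε : ℝ}, 0 < σ₀ → 0 < ε → ε ≤ 1 / σ₀ → σ₀ ≤ 1 / ε := fun h1 h2 h3 =>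
    (le_one_div h2 h1).1 h3
  refine ⟨⟨fun β hβ => ?_, ?_⟩, ?_⟩
  · obtain ⟨σ₀, hσ₀, h⟩ := hattr β hβ
    exact ⟨1 / σ₀, by positivity, fun ε hε hεs =>
      ⟨hcomplete _ (by positivity), h _ (hinvε hσ₀ hε hεs)⟩⟩
  -- The function `κ` has to dominate `N ‖z‖ + c₀ ‖x 0‖` for initial states in the invariant set and
  -- `N ‖x 0‖` for those outside.
  · obtain ⟨κ, hκ, hle⟩ := hred.exists_classK
      (norm_le_of_isSolution_reducedField hv0 hρ hin) hN.le (c := c₀ + N) (by positivity)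
    refine ⟨κ, hκ, fun β hβ => ?_⟩
    obtain ⟨σ₀, T, hσ₀, hT, h⟩ := hbounds β hβ
    refine ⟨1 / σ₀, by positivity, fun ε hε hεs => ⟨hcomplete _ (by positivity), ?_⟩⟩
    intro x hx t ht
    have hε0 : (0 : ℝ) ≤ 1 / ε := by positivity
    have hnn : 0 ≤ N * ‖x 0‖ := by positivity
    by_cases hx0 : maxNorm (x 0) ≤ ρ + 1
    · obtain ⟨-, z, hz, hz0, hzx⟩ := h _ (hinvε hσ₀ hε hεs) x hx fun s hs =>
        maxNorm_le_of_isSolution hl hρ hin hε0 hx (by linarith) hx0 hs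
      obtain ⟨s, hs, hsx⟩ := hzx t ht
      have h1 := hle z hz ‖x 0‖ (by
        rw [hz0]
        exact (norm_meanCLM_le_maxNorm hv0 hv.sum_eq_one _).trans (maxNorm_le_norm _)) s hs
      linarith
    -- Outside the invariant set the maximal norm does not exceed its initial value, which needs no
    -- condition on `σ₀`. The reduced solution from `0` serves only to extract the linear lower
    -- bound on `κ`.
    · obtain ⟨z, hz, hz0⟩ := hred.complete 0
      have h1 := hle z hz ‖x 0‖ (by simp [hz0]) 0 le_rfl
      have h2 := maxNorm_le_of_isSolution hl hρ hin hε0 hx (R := maxNorm (x 0)) (by linarith)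
        le_rfl ht
      have h3 := (norm_le_maxNorm (x t)).trans
        (mul_le_mul_of_nonneg_left (h2.trans (maxNorm_le_norm _)) hN.le)
      have h4 : 0 ≤ N * ‖z 0‖ := by positivity
      have h5 : 0 ≤ c₀ * ‖x 0‖ := by positivity
      linarith
  · intro V Vd r Vm α c hdec hr hDG
    obtain ⟨U, q, β, σ₁, hβ, hσ₁, hU, hU0, hUpos, hq, hq0, hqpos, hderiv⟩ :=
      exists_network_lyapunov hl hgraph hf hf0 hv hdec hr hDG
    -- Practical attractivity is applied with the radius on which the Lyapunov function is strict.
    obtain ⟨σ₀, hσ₀, hatt⟩ := hattr β hβ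
    refine ⟨max σ₀ σ₁, lt_max_of_lt_left hσ₀, fun σ hσ => ?_⟩
    obtain ⟨U', hU', hdecay⟩ := hderiv σ ((le_max_right _ _).trans hσ)
    have hσ₀σ := (le_max_left _ _).trans hσ
    refine ⟨hcomplete σ (hσ₀.trans_le hσ₀σ), ?_, fun x hx => ?_⟩
    · exact stable_of_lyapunov hβ hU hU0 (fun x hx _ => hUpos x hx) hU'
        fun x hx => (hdecay x hx).trans (neg_nonpos.2 (hq0 x))
    · obtain ⟨T, hT, hball⟩ := hatt σ hσ₀σ x hx
      exact tendsto_zero_of_lyapunov hU (fun x hx _ => hUpos x hx) hU0 hdecay hq hq0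
        (fun x hx _ => hqpos x hx) (hU' x hx) hT.le hball
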